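/- Let $r\ge 2$. For a prime $p$, a perfect field $k$ of characteristic $p$, and linear forms $l_1,\dots,l_r\in k[x,y]$ that are nonzero and pairwise without common non-unit factor, put $R=k[x,y]_{\langle x,y\rangle}$, $\mathfrak m=\langle x,y\rangle R$ and $f=l_1\cdots l_r$. For an ideal $I$ let $I^{[p^e]}$ be the ideal generated by the $p^e$-th powers of the elements of $I$. For real $t\ge 0$ let $$s(R,f^t)=\lim_{e\to\infty}\frac1{p^{2e}}\,\ell_R\!\left(\frac{R}{\mathfrak m^{[p^e]}:f^{\lceil t(p^e-1)\rceil}}\right)$$ be the F-signature of the pair $(R,f^t)$, and let $\mathrm{FPT}(f)$ be the F-pure threshold of $f$: the supremum of the $t\ge 0$ such that $(R,f^t)$ is F-pure, i.e. such that for all large $e$ the $R$-linear map $R\to F^e_*R$, $1\mapsto f^{\lfloor t(p^e-1)\rfloor}$, splits. Then the following hold. (1) For all $e,a\ge 0$ the module of syzygies of $(x^{p^e},y^{p^e},f^a)$ over $k[x,y]$ is generated by two homogeneous elements, of degrees $m_1\ge m_2$ say (a syzygy $(A,B,C)$ is homogeneous of degree $m$ if $Ax^{p^e}$, $By^{p^e}$,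 $Cf^a$ are homogeneous of degree $m$), and the syzygy gap $\delta(x^{p^e},y^{p^e},f^a)=m_1-m_2$ does not depend on the choice of the generators. There is a unique continuous function $\delta_f:[0,\infty)\to\mathbb R$ with $\delta_f(a/p^e)=p^{-e}\,\delta(x^{p^e},y^{p^e},f^a)$ for all $e,a\ge 0$. For every real $t\ge 0$ the limit $s(R,f^t)$ exists and $$s(R,f^t)=\frac{r^2}{4}t^2-rt+1-\left(\frac{\delta_f(t)}{2}\right)^2 .$$ (2) As $p\to\infty$, $s(R,f^t)$ converges uniformly on $[0,c]$, where $c=\mathrm{FPT}(f)$, to $\frac{r^2}{4}t^2-rt+1$. Precisely: for every $\varepsilon>0$ there is $P$, depending only on $r$ and $\varepsilon$, such that for all primes $p\ge P$, all $k$ and $l_1,\dots,l_r$ as above, and all $t\in[0,\mathrm{FPT}(f)]$, $$\left|\,s(R,f^t)-\left(\tfrac{r^2}{4}t^2-rt+1\right)\right|<\varepsilon .$$ -/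

import Mathlib

open Filter Topology
open scoped NNReal

/-- The Frobenius power `I^[p^e]`: the ideal generated by the `p^e`-th powers of elements of `I`. -/
def frobeniusPower {R : Type*} [CommRing R] (p : ℕ) (I : Ideal R) (e : ℕ) : Ideal R :=
  Ideal.span ((fun x : R => x ^ p ^ e) '' (I : Set R))

/-- The Krull dimension of a (nontrivial, finite-dimensional) ring, as a natural number. -/
noncomputable def krullDimNat (R : Type*) [CommRing R] : ℕ :=
  ((ringKrullDim R).unbotD 0).toNat

/-- The `e`-th term `ℓ_R (R / (𝔪^[p^e] : f^⌈t (p^e - 1)⌉)) / p^(e d)`, where `d = dim R`,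
of the sequence whose limit is the F-signature of the pair `(R, f^t)`. -/
noncomputable def fSignatureTerm {R : Type*} [CommRing R] [IsLocalRing R]
    (p : ℕ) (f : R) (t : ℝ) (e : ℕ) : ℝ :=
  ((Module.length R
      (R ⧸ Submodule.colon (frobeniusPower p (IsLocalRing.maximalIdeal R) e)
        {f ^ ⌈t * ((p : ℝ) ^ e - 1)⌉₊})).toNat : ℝ) / (p : ℝ) ^ (e * krullDimNat R)

/-- The F-signature `s(R, f^t)` of the pair `(R, f^t)`. -/
noncomputable def fSignature {R : Type*} [CommRing R] [IsLocalRing R]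
    (p : ℕ) (f : R) (t : ℝ) : ℝ :=
  limUnder atTop (fSignatureTerm p f t)

/-- The pair `(R, f^t)` is F-pure: for all large `e`, the `R`-linear map `R → F^e_* R` that sends
`1` to `f^⌊t (p^e - 1)⌋` splits. An `R`-linear map `F^e_* R → R` is the same as an additive map
`φ : R → R` with `φ (r^(p^e) x) = r φ x`. -/
def IsFPurePair {R : Type*} [CommRing R] (p : ℕ) (f : R) (t : ℝ) : Prop :=
  ∀ᶠ e : ℕ in atTop, ∃ φ : R →+ R,
    (∀ r x : R, φ (r ^ p ^ e * x) = r * φ x) ∧ φ (f ^ ⌊t * ((p : ℝ) ^ e - 1)⌋₊) = 1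

/-- The F-pure threshold of `f`. -/
noncomputable def fPureThreshold {R : Type*} [CommRing R] (p : ℕ) (f : R) : ℝ :=
  sSup {t : ℝ | 0 ≤ t ∧ IsFPurePair p f t}

/-- The ideal `⟨x, y⟩` of `k[x, y]`. -/
noncomputable def originIdeal (k : Type*) [Field k] : Ideal (MvPolynomial (Fin 2) k) :=
  Ideal.span {MvPolynomial.X 0, MvPolynomial.X 1}

theorem originIdeal_eq_ker (k : Type*) [Field k] :
    originIdeal k = RingHom.ker (MvPolynomial.constantCoeff (σ := Fin 2) (R := k)) := by
  have h : ({MvPolynomial.X 0, MvPolynomial.X 1} : Set (MvPolynomial (Fin 2) k)) =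
      MvPolynomial.X '' Set.univ := by
    ext a
    simp [Fin.exists_fin_two, eq_comm]
  ext a
  rw [originIdeal, h, MvPolynomial.mem_ideal_span_X_image, RingHom.mem_ker,
    MvPolynomial.constantCoeff_eq]
  constructor
  · intro H
    by_contra h0
    obtain ⟨i, -, hi⟩ := H 0 (MvPolynomial.mem_support_iff.2 h0)
    exact hi rfl
  · intro H m hm
    by_contra hne
    push Not at hne
    have : m = 0 := Finsupp.ext fun i => hne i (Set.mem_univ i)
    exact MvPolynomial.mem_support_iff.1 hm (this ▸ H)

instance originIdeal_isPrime (k : Type*) [Field k] : (originIdeal k).IsPrime := by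
  rw [originIdeal_eq_ker]
  exact RingHom.ker_isPrime _

/-- The local ring `R = k[x, y]_⟨x, y⟩`. -/
abbrev PlaneLocalRing (k : Type*) [Field k] : Type _ :=
  Localization.AtPrime (originIdeal k)

/-- `l` is a family of nonzero linear forms, no two of which have a common non-unit factor. -/
def AreDistinctLinearForms {k : Type*} [Field k] {r : ℕ}
    (l : Fin r → MvPolynomial (Fin 2) k) : Prop :=
  (∀ i, (l i).IsHomogeneous 1 ∧ l i ≠ 0) ∧ ∀ i j, i ≠ j → IsRelPrime (l i) (l j)

/-- The module of syzygies `A₀ F₀ + A₁ F₁ + A₂ F₂ = 0` of a triple of polynomials. -/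
noncomputable def syzygyModule {k : Type*} [Field k] (F : Fin 3 → MvPolynomial (Fin 2) k) :
    Submodule (MvPolynomial (Fin 2) k) (Fin 3 → MvPolynomial (Fin 2) k) :=
  LinearMap.ker (Fintype.linearCombination (MvPolynomial (Fin 2) k) F)

/-- `A` is homogeneous of degree `m` as a syzygy of `F`: each product `Aᵢ Fᵢ` is homogeneous of
degree `m`. -/
def IsHomogeneousSyzygy {k : Type*} [Field k] (F A : Fin 3 → MvPolynomial (Fin 2) k)
    (m : ℕ) : Prop :=
  A ∈ syzygyModule F ∧ ∀ i, (A i * F i).IsHomogeneous m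

/-- `d` is a syzygy gap of the triple `F`: the syzygy module of `F` is generated by two
homogeneous elements of degrees `m₁ ≥ m₂` with `m₁ - m₂ = d`. -/
def IsSyzygyGap {k : Type*} [Field k] (F : Fin 3 → MvPolynomial (Fin 2) k) (d : ℕ) : Prop :=
  ∃ (A B : Fin 3 → MvPolynomial (Fin 2) k) (m₁ m₂ : ℕ),
    IsHomogeneousSyzygy F A m₁ ∧ IsHomogeneousSyzygy F B m₂ ∧
    Submodule.span (MvPolynomial (Fin 2) k) {A, B} = syzygyModule F ∧
    m₁ = m₂ + d

/-- The triple `(x^(p^e), y^(p^e), f^a)`. -/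
noncomputable def frobeniusTriple {k : Type*} [Field k] (p : ℕ) (f : MvPolynomial (Fin 2) k)
    (e a : ℕ) : Fin 3 → MvPolynomial (Fin 2) k :=
  ![MvPolynomial.X 0 ^ p ^ e, MvPolynomial.X 1 ^ p ^ e, f ^ a]

/-- `δ` is the syzygy-gap function of `f`: the continuous function on `[0, ∞)` whose value at
`a / p^e` is the syzygy gap of `(x^(p^e), y^(p^e), f^a)` divided by `p^e`. -/
def IsSyzygyGapFunction {k : Type*} [Field k] (p : ℕ) (f : MvPolynomial (Fin 2) k)
    (δ : C(ℝ≥0, ℝ)) : Prop :=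
  ∀ e a d : ℕ, IsSyzygyGap (frobeniusTriple p f e a) d →
    δ ((a : ℝ≥0) / (p : ℝ≥0) ^ e) = (d : ℝ) / (p : ℝ) ^ e

/-! Part (1) is a dimension count in graded pieces. On the homogeneous syzygies of degree `n`,
evaluation at `(0, 1)` has kernel `x` times the syzygies of degree `n - 1`, so all dimensions are
encoded in the value spaces `V_n ⊆ k³`. These grow with `n` (multiply by `y`); for `(x^q, y^q, H)`
they have dimension at most 2, and eventually exactly 2. The two degrees where the dimension jumps
are the degrees of two generators, whence existence and uniqueness of the gap `δ`.

Projection to the third coordinate maps syzygies onto the graded pieces of `(x^q, y^q) : H`, with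
the Koszul syzygies as kernel. Summing over degrees gives `4 D = 4q² - 4qh + h² - δ²` for the
colength `D`, where `h = deg H` (`four_mul_finrank_add_gap`). Localizing at the origin does not
change `D`. For `q = p^e`, `H = f^a`, division by `4q²` is the asserted formula at `a / q`, and the
exponents in the F-signature satisfy `a / q → t`. The function `δ_f` exists because Frobenius
multiplies the gap by `p` (`gap_frobenius`) while a factor `f` changes it by at most `r`
(`gap_mul_le`): the values on the fractions `a / p^e` are well defined and Lipschitz.

Part (2) needs `δ_f = O(1/p)` on `[0, 2/r]`, which contains `[0, FPT(f)]`. The key is that the gap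
of `(x^p, y^p, f^b)` is at most `r` when `rb + 2 ≤ 2p` (`AreDistinctLinearForms.gap_le`). Were it
larger, `f` times a derivative of the minimal syzygy `v` would have too low a degree not to be a
multiple of `v`. Then `v₀` and `v₁` have equal logarithmic derivatives, so they are constant
multiples of one polynomial `w`, and `f^b` divides `w γ^p` for a linear form `γ`. At most one `lᵢ`
divides `γ`, so `deg w ≥ (r - 1) b`, too much for a minimal syzygy. The Lipschitz bound carries the
estimate from the fractions `b / p` to all `t`. -/

namespace PlaneSyzygy

open MvPolynomial

variable {k : Type*} [Field k]

/-! ### Homogeneous components of products -/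

section Graded

attribute [local instance] MvPolynomial.gradedAlgebra

theorem homogeneousComponent_mul_of_isHomogeneous {P : MvPolynomial (Fin 2) k} {m : ℕ}
    (hP : P.IsHomogeneous m) (u : MvPolynomial (Fin 2) k) (n : ℕ) :
    homogeneousComponent n (u * P) = if m ≤ n then homogeneousComponent (n - m) u * P else 0 := by
  have h := DirectSum.coe_decompose_mul_of_right_mem (𝒜 := homogeneousSubmodule (Fin 2) k)
    (a := u) n ((mem_homogeneousSubmodule m P).2 hP)
  have e : ∀ (φ : MvPolynomial (Fin 2) k) i,
      (DirectSum.decompose (homogeneousSubmodule (Fin 2) k) φ i : MvPolynomial (Fin 2) k) =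
        homogeneousComponent i φ := decomposition.decompose'_apply
  rwa [e, e] at h

end Graded

/-- The component of `u` of degree `n - m`, which is zero if `n < m`. -/
noncomputable def shiftedComponent (n m : ℕ) (u : MvPolynomial (Fin 2) k) :
    MvPolynomial (Fin 2) k :=
  if m ≤ n then homogeneousComponent (n - m) u else 0

theorem shiftedComponent_of_le {n m : ℕ} (h : m ≤ n) (u : MvPolynomial (Fin 2) k) :
    shiftedComponent n m u = homogeneousComponent (n - m) u := if_pos h

theorem shiftedComponent_of_lt {n m : ℕ} (h : n < m) (u : MvPolynomial (Fin 2) k) :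
    shiftedComponent n m u = 0 := if_neg (by omega)

theorem homogeneousComponent_mul {P : MvPolynomial (Fin 2) k} {m : ℕ}
    (hP : P.IsHomogeneous m) (u : MvPolynomial (Fin 2) k) (n : ℕ) :
    homogeneousComponent n (u * P) = shiftedComponent n m u * P := by
  rw [homogeneousComponent_mul_of_isHomogeneous hP, shiftedComponent]
  split_ifs <;> simp

theorem eq_shiftedComponent {P u : MvPolynomial (Fin 2) k} {m n : ℕ}
    (hP : P.IsHomogeneous m) (h0 : P ≠ 0) (h : (u * P).IsHomogeneous n) :
    u = shiftedComponent n m u := by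
  have h1 := homogeneousComponent_mul hP u n
  rw [homogeneousComponent_eq_self h] at h1
  exact mul_right_cancel₀ h0 h1

theorem shiftedComponent_mul_isHomogeneous {P : MvPolynomial (Fin 2) k} {m : ℕ}
    (hP : P.IsHomogeneous m) (u : MvPolynomial (Fin 2) k) (n : ℕ) :
    (shiftedComponent n m u * P).IsHomogeneous n := by
  rw [← homogeneousComponent_mul hP]
  exact homogeneousComponent_isHomogeneous _ _

theorem isHomogeneous_of_mul {P u : MvPolynomial (Fin 2) k} {m n : ℕ}
    (hP : P.IsHomogeneous m) (h0 : P ≠ 0) (h : (u * P).IsHomogeneous (n + m)) :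
    u.IsHomogeneous n := by
  rw [eq_shiftedComponent hP h0 h, shiftedComponent_of_le (by omega)]
  simpa using homogeneousComponent_isHomogeneous (n + m - m) u

/-! ### Evaluation at `(0, 1)` and the value spaces of homogeneous syzygies -/

/-- Evaluation at the point `(0, 1)`. -/
noncomputable def evalAt : MvPolynomial (Fin 2) k →ₐ[k] k := aeval ![0, 1]

@[simp] theorem evalAt_X_zero : evalAt (k := k) (X 0) = 0 := by simp [evalAt]

@[simp] theorem evalAt_X_one : evalAt (k := k) (X 1) = 1 := by simp [evalAt]

/-- The only monomial of degree `n` without a factor `x` is `y^n`, and its coefficient in a form is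
the value at `(0, 1)`. -/
theorem X_zero_dvd_of_evalAt {P : MvPolynomial (Fin 2) k} {n : ℕ} (hP : P.IsHomogeneous n)
    (h : evalAt P = 0) : X 0 ∣ P := by
  rw [← Ideal.mem_span_singleton, ← Set.image_singleton, mem_ideal_span_X_image]
  intro m hm
  refine ⟨0, rfl, fun h0 => ?_⟩
  have key : evalAt P = P.coeff m := by
    rw [evalAt, aeval_eq_eval, eval_eq', Finset.sum_eq_single m]
    · simp [Fin.prod_univ_two, h0]
    · intro d hd hne
      have : d 0 ≠ 0 := by
        intro hd0
        apply hne
        have h1 := hP (mem_support_iff.1 hm)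
        have h2 := hP (mem_support_iff.1 hd)
        simp only [Finsupp.weight_apply, Finsupp.sum_fintype, Fin.sum_univ_two, Pi.one_apply,
          smul_eq_mul, mul_one, implies_true] at h1 h2
        ext i
        fin_cases i
        · simp [h0, hd0]
        · simp only [Fin.mk_one]
          omega
      simp [Fin.prod_univ_two, this]
    · intro h; exact absurd hm h
  exact mem_support_iff.1 hm (key ▸ h)

variable {F : Fin 3 → MvPolynomial (Fin 2) k}

theorem mem_syzygyModule {A : Fin 3 → MvPolynomial (Fin 2) k} :
    A ∈ syzygyModule F ↔ A 0 * F 0 + A 1 * F 1 + A 2 * F 2 = 0 := by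
  simp [syzygyModule, Fintype.linearCombination_apply, Fin.sum_univ_three]

/-- The space of homogeneous syzygies of degree `n`. -/
noncomputable def syzygyPiece (F : Fin 3 → MvPolynomial (Fin 2) k) (n : ℕ) :
    Submodule k (Fin 3 → MvPolynomial (Fin 2) k) where
  carrier := {A | IsHomogeneousSyzygy F A n}
  zero_mem' := ⟨Submodule.zero_mem _, fun i => by simpa using isHomogeneous_zero _ _ _⟩
  add_mem' := fun ha hb => ⟨Submodule.add_mem _ ha.1 hb.1, fun i => by
    simpa [add_mul] using (ha.2 i).add (hb.2 i)⟩
  smul_mem' := fun c A hA => ⟨by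
    have := Submodule.smul_mem _ (C c : MvPolynomial (Fin 2) k) hA.1
    rwa [show (C c : MvPolynomial (Fin 2) k) • A = c • A by
      ext1 i; simp [smul_eq_C_mul]] at this, fun i => by
    simpa [smul_eq_C_mul, mul_assoc] using (hA.2 i).C_mul c⟩

@[simp] theorem mem_syzygyPiece {n : ℕ} {A : Fin 3 → MvPolynomial (Fin 2) k} :
    A ∈ syzygyPiece F n ↔ IsHomogeneousSyzygy F A n := Iff.rfl

theorem IsHomogeneousSyzygy.smul {A : Fin 3 → MvPolynomial (Fin 2) k} {m n : ℕ}
    (hA : IsHomogeneousSyzygy F A m) {u : MvPolynomial (Fin 2) k} (hu : u.IsHomogeneous n) :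
    IsHomogeneousSyzygy F (u • A) (n + m) :=
  ⟨Submodule.smul_mem _ _ hA.1, fun i => by
    simpa [mul_assoc] using hu.mul (hA.2 i)⟩

/-- Evaluation of a triple at `(0, 1)`. -/
noncomputable def evalVec : (Fin 3 → MvPolynomial (Fin 2) k) →ₗ[k] (Fin 3 → k) :=
  evalAt.toLinearMap.compLeft (Fin 3)

@[simp] theorem evalVec_apply (A : Fin 3 → MvPolynomial (Fin 2) k) (i : Fin 3) :
    evalVec A i = evalAt (A i) := rfl

theorem evalVec_smul (u : MvPolynomial (Fin 2) k) (A : Fin 3 → MvPolynomial (Fin 2) k) :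
    evalVec (u • A) = evalAt u • evalVec A := by
  ext i; simp

/-- The values at `(0, 1)` of the homogeneous syzygies of degree `n`. -/
noncomputable def valueSpace (F : Fin 3 → MvPolynomial (Fin 2) k) (n : ℕ) :
    Submodule k (Fin 3 → k) :=
  (syzygyPiece F n).map evalVec

theorem evalVec_mem_valueSpace {A : Fin 3 → MvPolynomial (Fin 2) k} {m n : ℕ}
    (hA : IsHomogeneousSyzygy F A m) (h : m ≤ n) : evalVec A ∈ valueSpace F n := by
  refine ⟨(X 1 ^ (n - m) : MvPolynomial (Fin 2) k) • A, ?_, ?_⟩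
  · have := IsHomogeneousSyzygy.smul hA (isHomogeneous_X_pow (R := k) (1 : Fin 2) (n - m))
    rwa [Nat.sub_add_cancel h] at this
  · simp [evalVec_smul]

section Division

variable {d : Fin 3 → ℕ} (hF : ∀ i, (F i).IsHomogeneous (d i)) (h0 : ∀ i, F i ≠ 0)

include hF h0

theorem X_zero_dvd_of_evalVec {A : Fin 3 → MvPolynomial (Fin 2) k} {n : ℕ}
    (hA : IsHomogeneousSyzygy F A n) (h : evalVec A = 0) (i : Fin 3) : X 0 ∣ A i := by
  have h1 := eq_shiftedComponent (hF i) (h0 i) (hA.2 i)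
  rcases le_or_gt (d i) n with hd | hd
  · rw [shiftedComponent_of_le hd] at h1
    refine X_zero_dvd_of_evalAt (n := n - d i) ?_ (congrFun h i)
    rw [h1]; exact homogeneousComponent_isHomogeneous _ _
  · rw [shiftedComponent_of_lt hd] at h1
    rw [h1]; exact dvd_zero _

/-- The exactness behind the dimension counts and the induction on degrees: a syzygy with value zero
can be divided by `x`. -/
theorem exists_smul_of_evalVec_succ {A : Fin 3 → MvPolynomial (Fin 2) k} {n : ℕ}
    (hA : IsHomogeneousSyzygy F A (n + 1)) (h : evalVec A = 0) :
    ∃ A', IsHomogeneousSyzygy F A' n ∧ A = (X 0 : MvPolynomial (Fin 2) k) • A' := by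
  choose A' hA' using X_zero_dvd_of_evalVec hF h0 hA h
  have e : A = (X 0 : MvPolynomial (Fin 2) k) • A' := funext fun i => by simp [hA' i]
  refine ⟨A', ⟨?_, fun i => ?_⟩, e⟩
  · have := mem_syzygyModule.1 hA.1
    rw [mem_syzygyModule]
    refine mul_left_cancel₀ (X_ne_zero (R := k) (0 : Fin 2)) ?_
    rw [mul_zero, ← this, hA' 0, hA' 1, hA' 2]; ring
  · refine isHomogeneous_of_mul (isHomogeneous_X k (0 : Fin 2)) (X_ne_zero _) ?_
    have := hA.2 i
    rwa [hA' i, mul_assoc, mul_comm] at this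

/-- Start of the induction: in degree 0 each `A i * F i` is a constant divisible by `x`. -/
theorem eq_zero_of_evalVec_zero {A : Fin 3 → MvPolynomial (Fin 2) k}
    (hA : IsHomogeneousSyzygy F A 0) (h : evalVec A = 0) : A = 0 := by
  have h1 := X_zero_dvd_of_evalVec hF h0 hA h
  funext i
  have h2 := (totalDegree_zero_iff_isHomogeneous _).2 (hA.2 i)
  have : A i * F i = 0 := by
    obtain ⟨c, hc⟩ : ∃ c, A i * F i = C c := ⟨_, (totalDegree_eq_zero_iff_eq_C.1 h2)⟩
    obtain ⟨B, hB⟩ := h1 i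
    have h3 := congrArg evalAt hc
    rw [hB] at h3
    simp [evalAt] at h3
    rw [hc, ← h3]; simp
  simpa using (mul_eq_zero.1 this).resolve_right (h0 i)

omit h0 in
theorem shiftedComponent_mem {z : Fin 3 → MvPolynomial (Fin 2) k} (hz : z ∈ syzygyModule F)
    (n : ℕ) : IsHomogeneousSyzygy F (fun i => shiftedComponent n (d i) (z i)) n := by
  refine ⟨?_, fun i => shiftedComponent_mul_isHomogeneous (hF i) _ _⟩
  have h := congrArg (homogeneousComponent n) (mem_syzygyModule.1 hz)
  rw [mem_syzygyModule]
  simpa [homogeneousComponent_mul (hF _)] using h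

theorem exists_eq_sum_shiftedComponent (z : Fin 3 → MvPolynomial (Fin 2) k) :
    ∃ N, z = ∑ n ∈ Finset.range N, fun i => shiftedComponent n (d i) (z i) := by
  refine ⟨(∑ i, (z i * F i).totalDegree) + 1, ?_⟩
  funext i
  refine mul_right_cancel₀ (h0 i) ?_
  rw [Finset.sum_apply, Finset.sum_mul]
  simp_rw [← homogeneousComponent_mul (hF i)]
  conv_lhs => rw [← sum_homogeneousComponent (z i * F i)]
  refine Finset.sum_subset ?_ fun n _ hn => homogeneousComponent_eq_zero _ _ (by simpa using hn)
  have := Finset.single_le_sum (f := fun i => (z i * F i).totalDegree) (fun _ _ => Nat.zero_le _)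
    (Finset.mem_univ i)
  exact Finset.range_mono (by simpa using this)

end Division

/-! ### Pairs of homogeneous generators: existence and uniqueness of degrees -/

/-- `A`, `B` are homogeneous generators of degrees `m₁ ≥ m₂` of the syzygy module of `F`. -/
structure IsGeneratingPair (F A B : Fin 3 → MvPolynomial (Fin 2) k) (m₁ m₂ : ℕ) : Prop where
  left : IsHomogeneousSyzygy F A m₁
  right : IsHomogeneousSyzygy F B m₂
  span : Submodule.span (MvPolynomial (Fin 2) k) {A, B} = syzygyModule F
  le : m₂ ≤ m₁

theorem isSyzygyGap_iff {δ : ℕ} :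
    IsSyzygyGap F δ ↔ ∃ A B m₁ m₂, IsGeneratingPair F A B m₁ m₂ ∧ m₁ = m₂ + δ :=
  ⟨fun ⟨A, B, m₁, m₂, h1, h2, h3, h4⟩ => ⟨A, B, m₁, m₂, ⟨h1, h2, h3, by omega⟩, h4⟩,
    fun ⟨A, B, m₁, m₂, h, h4⟩ => ⟨A, B, m₁, m₂, h.1, h.2, h.3, h4⟩⟩

theorem eq_of_forall_ite_add_ite {m₁ m₂ n₁ n₂ : ℕ} (hm : m₂ ≤ m₁) (hn : n₂ ≤ n₁)
    (e : ∀ n : ℕ, ((if m₁ ≤ n then 1 else 0) + (if m₂ ≤ n then 1 else 0) : ℕ) =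
      (if n₁ ≤ n then 1 else 0) + if n₂ ≤ n then 1 else 0) : n₁ = m₁ ∧ n₂ = m₂ := by
  have e1 := e m₁
  have e2 := e m₂
  have e3 := e n₁
  have e4 := e n₂
  clear e
  grind

section Generators

variable (h0 : ∀ i, F i ≠ 0)
  {A B : Fin 3 → MvPolynomial (Fin 2) k} {m₁ m₂ : ℕ}

include h0

theorem IsGeneratingPair.exists_eq (h : IsGeneratingPair F A B m₁ m₂)
    {z : Fin 3 → MvPolynomial (Fin 2) k} {n : ℕ} (hz : IsHomogeneousSyzygy F z n) :
    ∃ u v : MvPolynomial (Fin 2) k,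
      z = shiftedComponent n m₁ u • A + shiftedComponent n m₂ v • B := by
  have hz' := hz.1
  rw [← h.span, Submodule.mem_span_pair] at hz'
  obtain ⟨u, v, huv⟩ := hz'
  refine ⟨u, v, funext fun i => mul_right_cancel₀ (h0 i) ?_⟩
  have h1 : homogeneousComponent n ((u • A + v • B) i * F i) = homogeneousComponent n (z i * F i) := by
    rw [huv]
  simp only [Pi.add_apply, Pi.smul_apply, smul_eq_mul, add_mul, mul_assoc, map_add] at h1
  rw [homogeneousComponent_mul (h.left.2 i), homogeneousComponent_mul (h.right.2 i),
    homogeneousComponent_eq_self (hz.2 i)] at h1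
  rw [← h1]
  simp [add_mul, mul_assoc]

theorem IsGeneratingPair.syzygyPiece_eq_bot (h : IsGeneratingPair F A B m₁ m₂) {n : ℕ}
    (hn : n < m₂) : syzygyPiece F n = ⊥ := by
  rw [eq_bot_iff]
  intro z hz
  obtain ⟨u, v, rfl⟩ := h.exists_eq h0 hz
  rw [shiftedComponent_of_lt hn, shiftedComponent_of_lt (hn.trans_le h.le)]
  simp

theorem IsGeneratingPair.exists_eq_smul (h : IsGeneratingPair F A B m₁ m₂) {n : ℕ}
    (hn : n < m₁) {z : Fin 3 → MvPolynomial (Fin 2) k} (hz : IsHomogeneousSyzygy F z n) :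
    ∃ v : MvPolynomial (Fin 2) k, z = v • B := by
  obtain ⟨u, v, rfl⟩ := h.exists_eq h0 hz
  exact ⟨shiftedComponent n m₂ v, by rw [shiftedComponent_of_lt hn]; simp⟩

theorem IsGeneratingPair.valueSpace_le (h : IsGeneratingPair F A B m₁ m₂) (n : ℕ) :
    valueSpace F n ≤ Submodule.span k {evalVec A, evalVec B} := by
  rintro _ ⟨z, hz, rfl⟩
  obtain ⟨u, v, rfl⟩ := h.exists_eq h0 hz
  rw [map_add, evalVec_smul, evalVec_smul]
  exact Submodule.mem_span_pair.2 ⟨_, _, rfl⟩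

theorem IsGeneratingPair.valueSpace_le_singleton (h : IsGeneratingPair F A B m₁ m₂) {n : ℕ}
    (hn : n < m₁) : valueSpace F n ≤ Submodule.span k {evalVec B} := by
  rintro _ ⟨z, hz, rfl⟩
  obtain ⟨v, rfl⟩ := h.exists_eq_smul h0 hn hz
  rw [evalVec_smul]
  exact Submodule.smul_mem _ _ (Submodule.mem_span_singleton_self _)

theorem IsGeneratingPair.finrank_span (h : IsGeneratingPair F A B m₁ m₂)
    (hbig : ∃ N, Module.finrank k (valueSpace F N) = 2) :
    Module.finrank k (Submodule.span k {evalVec A, evalVec B}) = 2 := by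
  classical
  obtain ⟨N, hN⟩ := hbig
  refine le_antisymm ?_ (hN.symm.le.trans (Submodule.finrank_mono (h.valueSpace_le h0 N)))
  have := finrank_span_finset_le_card (R := k) ({evalVec A, evalVec B} : Finset (Fin 3 → k))
  rw [Finset.coe_pair] at this
  exact this.trans Finset.card_le_two

/-- Below `m₂` there are no syzygies, below `m₁` only multiples of `B`, and from `m₁` on both values
occur. They are independent because their span contains a plane `V_N`. The jumps of this function
recover the degrees. -/
theorem IsGeneratingPair.finrank_valueSpace (h : IsGeneratingPair F A B m₁ m₂)
    (hbig : ∃ N, Module.finrank k (valueSpace F N) = 2) (n : ℕ) :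
    Module.finrank k (valueSpace F n) = (if m₁ ≤ n then 1 else 0) + if m₂ ≤ n then 1 else 0 := by
  have h2 := h.finrank_span h0 hbig
  have hle := h.le
  rcases lt_or_ge n m₂ with hn | hn
  · rw [valueSpace, h.syzygyPiece_eq_bot h0 hn, if_neg (by omega), if_neg (by omega)]
    simp
  rcases lt_or_ge n m₁ with hn' | hn'
  · rw [if_neg (by omega), if_pos hn]
    have : valueSpace F n = Submodule.span k {evalVec B} := by
      refine le_antisymm (h.valueSpace_le_singleton h0 hn') ?_
      rw [Submodule.span_singleton_le_iff_mem]
      exact evalVec_mem_valueSpace h.right hn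
    rw [this, finrank_span_singleton, zero_add]
    intro hB
    rw [hB, Set.pair_comm, Submodule.span_insert_zero] at h2
    have := finrank_span_finset_le_card (R := k) ({evalVec A} : Finset (Fin 3 → k))
    rw [Finset.coe_singleton, Set.finrank, h2] at this
    simp at this
  · rw [if_pos hn', if_pos hn, show 1 + 1 = 2 from rfl, ← h2]
    have : valueSpace F n = Submodule.span k {evalVec A, evalVec B} := by
      refine le_antisymm (h.valueSpace_le h0 n) ?_
      rw [Submodule.span_le]
      rintro _ (rfl | rfl)
      · exact evalVec_mem_valueSpace h.left hn'
      · exact evalVec_mem_valueSpace h.right hn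
    rw [this]

theorem IsGeneratingPair.degrees_unique (h : IsGeneratingPair F A B m₁ m₂)
    (hbig : ∃ N, Module.finrank k (valueSpace F N) = 2)
    {A' B' : Fin 3 → MvPolynomial (Fin 2) k} {n₁ n₂ : ℕ} (h' : IsGeneratingPair F A' B' n₁ n₂) :
    n₁ = m₁ ∧ n₂ = m₂ := by
  refine eq_of_forall_ite_add_ite h.le h'.le fun n => ?_
  rw [← h.finrank_valueSpace h0 hbig, ← h'.finrank_valueSpace h0 hbig]

variable {d : Fin 3 → ℕ} (hF : ∀ i, (F i).IsHomogeneous (d i))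

include hF

/-- `B` is taken in the first degree with a nonzero value space, and `A` in the first degree with a
plane, with value off the line of `B`. Generation follows by induction on the degree. -/
theorem exists_isGeneratingPair (hdim : ∀ n, Module.finrank k (valueSpace F n) ≤ 2)
    (hbig : ∃ N, Module.finrank k (valueSpace F N) = 2) :
    ∃ A B m₁ m₂, IsGeneratingPair F A B m₁ m₂ := by
  classical
  have hpos : ∃ N, 0 < Module.finrank k (valueSpace F N) := hbig.imp fun N h => by omega
  obtain ⟨m₂, hm₂, hlt₂⟩ : ∃ m, 0 < Module.finrank k (valueSpace F m) ∧
      ∀ n < m, Module.finrank k (valueSpace F n) = 0 :=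
    ⟨_, Nat.find_spec hpos, fun n hn => by simpa using Nat.find_min hpos hn⟩
  obtain ⟨m₁, hm₁, hlt₁⟩ : ∃ m, Module.finrank k (valueSpace F m) = 2 ∧
      ∀ n < m, Module.finrank k (valueSpace F n) ≠ 2 :=
    ⟨_, Nat.find_spec hbig, fun n hn => Nat.find_min hbig hn⟩
  have hle : m₂ ≤ m₁ := by
    by_contra hc
    have := hlt₂ m₁ (by omega)
    omega
  obtain ⟨_, ⟨B, hB, rfl⟩, hB0⟩ : ∃ b ∈ valueSpace F m₂, b ≠ 0 := by
    by_contra! hc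
    rw [(Submodule.eq_bot_iff _).2 hc] at hm₂
    simp at hm₂
  obtain ⟨_, ⟨A, hA, rfl⟩, hA0⟩ :
      ∃ a ∈ valueSpace F m₁, a ∉ Submodule.span k {evalVec B} := by
    by_contra! hc
    have h1 := Submodule.finrank_mono (show valueSpace F m₁ ≤ _ from hc)
    rw [finrank_span_singleton hB0] at h1
    omega
  have hind : ∀ a, a ∉ Submodule.span k {evalVec B} →
      Module.finrank k (Submodule.span k {evalVec B, a}) = 2 := fun a ha => by
    have h3 : LinearIndependent k ![evalVec B, a] := by
      rw [LinearIndependent.pair_iff' hB0]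
      exact fun c hc => ha (hc ▸ Submodule.smul_mem _ _ (Submodule.mem_span_singleton_self _))
    have := finrank_span_eq_card h3
    rwa [Matrix.range_cons, Matrix.range_cons, Matrix.range_empty, Set.union_empty,
      Set.singleton_union, Fintype.card_fin] at this
  have hgen : ∀ n z, IsHomogeneousSyzygy F z n →
      z ∈ Submodule.span (MvPolynomial (Fin 2) k) {A, B} := by
    intro n
    induction n using Nat.strong_induction_on with
    | _ n ih =>
    intro z hz
    have hv : evalVec z ∈ valueSpace F n := ⟨z, hz, rfl⟩
    -- A combination of `A` and `B`, padded by powers of `y` (which have value 1), matches the value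
    -- of `z`. The difference is then `x` times a syzygy of lower degree, or zero when `n = 0`.
    obtain ⟨z', hz', hz'', hev⟩ : ∃ z', IsHomogeneousSyzygy F z' n ∧
        z' ∈ Submodule.span (MvPolynomial (Fin 2) k) {A, B} ∧ evalVec z' = evalVec z := by
      have hBn : m₂ ≤ n → IsHomogeneousSyzygy F
          ((X 1 ^ (n - m₂) : MvPolynomial (Fin 2) k) • B) n := fun h => by
        have := IsHomogeneousSyzygy.smul hB (isHomogeneous_X_pow (R := k) (1 : Fin 2) (n - m₂))
        rwa [Nat.sub_add_cancel h] at this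
      have hAn : m₁ ≤ n → IsHomogeneousSyzygy F
          ((X 1 ^ (n - m₁) : MvPolynomial (Fin 2) k) • A) n := fun h => by
        have := IsHomogeneousSyzygy.smul hA (isHomogeneous_X_pow (R := k) (1 : Fin 2) (n - m₁))
        rwa [Nat.sub_add_cancel h] at this
      have hA' : A ∈ Submodule.span (MvPolynomial (Fin 2) k) {A, B} :=
        Submodule.subset_span (by simp)
      have hB' : B ∈ Submodule.span (MvPolynomial (Fin 2) k) {A, B} :=
        Submodule.subset_span (by simp)
      rcases lt_or_ge n m₂ with hn | hn
      · refine ⟨0, (syzygyPiece F n).zero_mem, Submodule.zero_mem _, ?_⟩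
        rw [Submodule.finrank_eq_zero.1 (hlt₂ n hn), Submodule.mem_bot] at hv
        rw [hv, map_zero]
      rcases lt_or_ge n m₁ with hn' | hn'
      · have : evalVec z ∈ Submodule.span k {evalVec B} := by
          -- A value off the line of `B` would produce a plane before degree `m₁`.
          by_contra hc
          have h1 : Submodule.span k {evalVec B, evalVec z} ≤ valueSpace F n := by
            rw [Submodule.span_le]
            rintro _ (rfl | rfl)
            · exact evalVec_mem_valueSpace hB hn
            · exact hv
          have h2 := Submodule.finrank_mono h1
          rw [hind _ hc] at h2
          exact hlt₁ n hn' (le_antisymm (hdim n) h2)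
        obtain ⟨c, hc⟩ := Submodule.mem_span_singleton.1 this
        refine ⟨c • ((X 1 ^ (n - m₂) : MvPolynomial (Fin 2) k) • B),
          (syzygyPiece F n).smul_mem c (hBn hn), ?_, ?_⟩
        · exact Submodule.smul_of_tower_mem _ c (Submodule.smul_mem _ _ hB')
        · rw [evalVec.map_smul c, evalVec_smul, ← hc]; simp
      · have h1 : Submodule.span k {evalVec B, evalVec A} ≤ valueSpace F n := by
          rw [Submodule.span_le]
          rintro _ (rfl | rfl)
          · exact evalVec_mem_valueSpace hB hn
          · exact evalVec_mem_valueSpace hA hn'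
        rw [← Submodule.eq_of_le_of_finrank_le h1 (by rw [hind _ hA0]; exact hdim n),
          Submodule.mem_span_pair] at hv
        obtain ⟨b, a, hab⟩ := hv
        refine ⟨b • ((X 1 ^ (n - m₂) : MvPolynomial (Fin 2) k) • B) +
          a • ((X 1 ^ (n - m₁) : MvPolynomial (Fin 2) k) • A),
          (syzygyPiece F n).add_mem ((syzygyPiece F n).smul_mem b (hBn hn))
            ((syzygyPiece F n).smul_mem a (hAn hn')), ?_, ?_⟩
        · exact Submodule.add_mem _
            (Submodule.smul_of_tower_mem _ b (Submodule.smul_mem _ _ hB'))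
            (Submodule.smul_of_tower_mem _ a (Submodule.smul_mem _ _ hA'))
        · rw [map_add, evalVec.map_smul b, evalVec.map_smul a, evalVec_smul, evalVec_smul, ← hab]
          simp
    have hsub : IsHomogeneousSyzygy F (z - z') n := (syzygyPiece F n).sub_mem hz hz'
    have hsub0 : evalVec (z - z') = 0 := by rw [map_sub, hev, sub_self]
    have hz2 : z = z' + (z - z') := by abel
    rw [hz2]
    refine Submodule.add_mem _ hz'' ?_
    rcases n with _ | n
    · rw [eq_zero_of_evalVec_zero hF h0 hsub hsub0]
      exact Submodule.zero_mem _
    · obtain ⟨y, hy, hy'⟩ := exists_smul_of_evalVec_succ hF h0 hsub hsub0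
      rw [hy']
      exact Submodule.smul_mem _ _ (ih n (by omega) y hy)
  refine ⟨A, B, m₁, m₂, hA, hB, le_antisymm ?_ ?_, hle⟩
  · rw [Submodule.span_le]
    rintro _ (rfl | rfl)
    · exact hA.1
    · exact hB.1
  · intro z hz
    obtain ⟨N, hN⟩ := exists_eq_sum_shiftedComponent hF h0 z
    rw [hN]
    exact Submodule.sum_mem _ fun n _ => hgen n _ (shiftedComponent_mem hF hz n)

end Generators

/-! ### Dimensions of spaces of forms and of syzygies -/

/-- Rank-nullity for `ev` on `U'`, whose kernel is the injective image of `U`. It is applied with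
`μ` multiplication by `x` and `ev` evaluation at `(0, 1)`, so dimensions add up degree by degree. -/
theorem finrank_eq_add_finrank_map {V W : Type*} [AddCommGroup V] [Module k V] [AddCommGroup W] [Module k W]
    [FiniteDimensional k W] (U U' : Submodule k V) (μ : V →ₗ[k] V) (hμ : Function.Injective μ)
    (ev : V →ₗ[k] W) (h₁ : ∀ v ∈ U', ev v = 0 → ∃ u ∈ U, μ u = v)
    (h₂ : ∀ u ∈ U, μ u ∈ U' ∧ ev (μ u) = 0) (hU : FiniteDimensional k U) :
    FiniteDimensional k U' ∧
      Module.finrank k U' = Module.finrank k U + Module.finrank k (U'.map ev) := by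
  have e : U' ⊓ LinearMap.ker ev = U.map μ := by
    ext v
    constructor
    · rintro ⟨hv, hv0⟩
      exact h₁ v hv hv0
    · rintro ⟨u, hu, rfl⟩
      exact h₂ u hu
  have hfin : FiniteDimensional k U' := by
    rw [← Submodule.fg_iff_finiteDimensional]
    refine Submodule.fg_of_fg_map_of_fg_inf_ker ev
      ((Submodule.fg_iff_finiteDimensional _).2 inferInstance) ?_
    rw [e]
    exact ((Submodule.fg_iff_finiteDimensional U).2 hU).map μ
  refine ⟨hfin, ?_⟩
  have h := LinearMap.finrank_range_add_finrank_ker (ev.domRestrict U')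
  rw [LinearMap.range_domRestrict, LinearMap.ker_domRestrict] at h
  rw [← h, add_comm]
  congr 1
  rw [LinearEquiv.finrank_eq (Submodule.equivMapOfInjective μ hμ U), ← e]
  have h3 := LinearEquiv.finrank_eq (Submodule.equivMapOfInjective U'.subtype
    U'.injective_subtype ((LinearMap.ker ev).submoduleOf U'))
  rw [Submodule.submoduleOf, Submodule.map_comap_subtype] at h3
  exact h3

theorem homogeneousSubmodule_finrank (n : ℕ) :
    FiniteDimensional k (homogeneousSubmodule (Fin 2) k n) ∧
      Module.finrank k (homogeneousSubmodule (Fin 2) k n) = n + 1 := by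
  have hinj : Function.Injective (LinearMap.mulLeft k (X 0 : MvPolynomial (Fin 2) k)) :=
    fun a b h => mul_left_cancel₀ (X_ne_zero (0 : Fin 2)) h
  have hmap : ∀ n, Module.finrank k ((homogeneousSubmodule (Fin 2) k n).map
      evalAt.toLinearMap) = 1 := fun n => by
    rw [show (homogeneousSubmodule (Fin 2) k n).map evalAt.toLinearMap = ⊤ from ?_,
      finrank_top, Module.finrank_self]
    rw [eq_top_iff]
    rintro c -
    exact ⟨c • X 1 ^ n, Submodule.smul_mem _ _ (isHomogeneous_X_pow _ _), by simp⟩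
  induction n with
  | zero =>
    have := finrank_eq_add_finrank_map (⊥ : Submodule k (MvPolynomial (Fin 2) k))
      (homogeneousSubmodule (Fin 2) k 0) _ hinj evalAt.toLinearMap ?_ ?_ inferInstance
    · rw [hmap, finrank_bot] at this
      exact this
    · intro v hv hv0
      refine ⟨0, by simp, ?_⟩
      have := totalDegree_eq_zero_iff_eq_C.1 ((totalDegree_zero_iff_isHomogeneous _).2 hv)
      rw [this] at hv0 ⊢
      simp only [AlgHom.toLinearMap_apply, evalAt, aeval_C] at hv0
      simp only [Algebra.algebraMap_self, RingHom.id_apply] at hv0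
      simp [hv0]
    · intro u hu
      rw [(Submodule.mem_bot k).1 hu]
      simp
  | succ n ih =>
    have := finrank_eq_add_finrank_map (homogeneousSubmodule (Fin 2) k n)
      (homogeneousSubmodule (Fin 2) k (n + 1)) _ hinj evalAt.toLinearMap ?_ ?_ ih.1
    · rw [hmap, ih.2] at this
      exact this
    · intro v hv hv0
      obtain ⟨u, hu⟩ := X_zero_dvd_of_evalAt hv hv0
      refine ⟨u, ?_, hu.symm⟩
      rw [mem_homogeneousSubmodule, hu, mul_comm] at hv
      exact isHomogeneous_of_mul (isHomogeneous_X k (0 : Fin 2)) (X_ne_zero _) hv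
    · intro u hu
      refine ⟨?_, by simp⟩
      rw [add_comm]
      exact (isHomogeneous_X k (0 : Fin 2)).mul hu

instance (n : ℕ) : FiniteDimensional k (homogeneousSubmodule (Fin 2) k n) :=
  (homogeneousSubmodule_finrank n).1

section Pieces

variable {F : Fin 3 → MvPolynomial (Fin 2) k} {d : Fin 3 → ℕ}
  (hF : ∀ i, (F i).IsHomogeneous (d i)) (h0 : ∀ i, F i ≠ 0)

include hF h0

theorem syzygyPiece_finrank (n : ℕ) :
    FiniteDimensional k (syzygyPiece F n) ∧ Module.finrank k (syzygyPiece F n) =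
      ∑ i ∈ Finset.range (n + 1), Module.finrank k (valueSpace F i) := by
  set μ : (Fin 3 → MvPolynomial (Fin 2) k) →ₗ[k] (Fin 3 → MvPolynomial (Fin 2) k) :=
    (LinearMap.mulLeft k (X 0 : MvPolynomial (Fin 2) k)).compLeft (Fin 3) with hμ
  have hμ' : ∀ A, μ A = (X 0 : MvPolynomial (Fin 2) k) • A := fun A => rfl
  have hinj : Function.Injective μ := fun a b h => by
    funext i
    exact mul_left_cancel₀ (X_ne_zero (0 : Fin 2)) (congrFun h i)
  induction n with
  | zero =>
    have := finrank_eq_add_finrank_map (⊥ : Submodule k (Fin 3 → MvPolynomial (Fin 2) k))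
      (syzygyPiece F 0) _ hinj evalVec ?_ ?_ inferInstance
    · rw [finrank_bot] at this
      refine ⟨this.1, ?_⟩
      rw [zero_add, Finset.sum_range_one, this.2, zero_add]
      rfl
    · intro v hv hv0
      exact ⟨0, by simp, by rw [eq_zero_of_evalVec_zero hF h0 hv hv0, map_zero]⟩
    · intro u hu
      rw [(Submodule.mem_bot k).1 hu]
      simp only [map_zero, and_true]
      exact Submodule.zero_mem _
  | succ n ih =>
    have := finrank_eq_add_finrank_map (syzygyPiece F n) (syzygyPiece F (n + 1)) _ hinj evalVec ?_ ?_ ih.1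
    · rw [ih.2] at this
      rw [Finset.sum_range_succ]
      exact this
    · intro v hv hv0
      obtain ⟨u, hu, hu'⟩ := exists_smul_of_evalVec_succ hF h0 hv hv0
      exact ⟨u, hu, by rw [hμ', hu']⟩
    · intro u hu
      rw [hμ', evalVec_smul]
      refine ⟨?_, by simp⟩
      rw [add_comm]
      exact IsHomogeneousSyzygy.smul hu (isHomogeneous_X k (0 : Fin 2))

/-- The Hilbert function of a free module with generators in degrees `m₁`, `m₂`; truncated
subtraction drops a generator that has not yet appeared. -/
theorem IsGeneratingPair.finrank_syzygyPiece {A B : Fin 3 → MvPolynomial (Fin 2) k} {m₁ m₂ : ℕ}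
    (h : IsGeneratingPair F A B m₁ m₂)
    (hbig : ∃ N, Module.finrank k (valueSpace F N) = 2) (n : ℕ) :
    Module.finrank k (syzygyPiece F n) = (n + 1 - m₁) + (n + 1 - m₂) := by
  rw [(syzygyPiece_finrank hF h0 n).2]
  induction n with
  | zero =>
    rw [Finset.sum_range_one, h.finrank_valueSpace h0 hbig]
    split_ifs <;> omega
  | succ n ih =>
    rw [Finset.sum_range_succ, ih, h.finrank_valueSpace h0 hbig]
    split_ifs <;> omega

end Pieces

/-! ### The triple `(x^q, y^q, H)` and the colength of `(x^q, y^q) : H` -/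

/-- The triple `(x^q, y^q, H)`. -/
noncomputable def powTriple (q : ℕ) (H : MvPolynomial (Fin 2) k) :
    Fin 3 → MvPolynomial (Fin 2) k :=
  ![X 0 ^ q, X 1 ^ q, H]

theorem mem_syzygyModule_powTriple {q : ℕ} {H : MvPolynomial (Fin 2) k}
    {A : Fin 3 → MvPolynomial (Fin 2) k} :
    A ∈ syzygyModule (powTriple q H) ↔ A 0 * X 0 ^ q + A 1 * X 1 ^ q + A 2 * H = 0 :=
  mem_syzygyModule

theorem isHomogeneousSyzygy_powTriple {q : ℕ} {H : MvPolynomial (Fin 2) k}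
    {A : Fin 3 → MvPolynomial (Fin 2) k} {n : ℕ} :
    IsHomogeneousSyzygy (powTriple q H) A n ↔ A 0 * X 0 ^ q + A 1 * X 1 ^ q + A 2 * H = 0 ∧
      (A 0 * X 0 ^ q).IsHomogeneous n ∧ (A 1 * X 1 ^ q).IsHomogeneous n ∧
      (A 2 * H).IsHomogeneous n := by
  rw [IsHomogeneousSyzygy, mem_syzygyModule_powTriple, Fin.forall_fin_succ, Fin.forall_fin_succ,
    Fin.forall_fin_one]
  rfl

section Triple

variable {q h : ℕ} (hq : 0 < q) {H : MvPolynomial (Fin 2) k} (hH : H.IsHomogeneous h)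
  (hH0 : H ≠ 0)

include hH in
theorem powTriple_isHomogeneous (i : Fin 3) :
    (powTriple q H i).IsHomogeneous ((![q, q, h] : Fin 3 → ℕ) i) := by
  fin_cases i
  · exact isHomogeneous_X_pow _ _
  · exact isHomogeneous_X_pow _ _
  · exact hH

include hH0 in
theorem powTriple_ne_zero (i : Fin 3) : powTriple q H i ≠ 0 := by
  fin_cases i
  · exact pow_ne_zero _ (X_ne_zero _)
  · exact pow_ne_zero _ (X_ne_zero _)
  · exact hH0

-- At `(0, 1)` the syzygy relation reads `A₁ + A₂ H(0, 1) = 0`, since `x^q` vanishes there for `q >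
-- 0`; so `(0, 1, 0)` is not a value.
include hq in
theorem finrank_valueSpace_powTriple_le (n : ℕ) :
    Module.finrank k (valueSpace (powTriple q H) n) ≤ 2 := by
  have h1 : valueSpace (powTriple q H) n < ⊤ := by
    rw [lt_top_iff_ne_top]
    intro ht
    have : (![0, 1, 0] : Fin 3 → k) ∈ valueSpace (powTriple q H) n := ht ▸ Submodule.mem_top
    obtain ⟨A, hA, he⟩ := this
    have h2 := congrArg evalAt (mem_syzygyModule_powTriple.1 hA.1)
    have e1 := congrFun he 1
    have e2 := congrFun he 2
    simp only [evalVec_apply] at e1 e2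
    simp [e1, e2, hq.ne'] at h2
  have := Submodule.finrank_lt h1.ne
  rw [Module.finrank_fin_fun] at this
  omega

theorem isHomogeneousSyzygy_koszul {u : MvPolynomial (Fin 2) k} {m : ℕ} (hu : u.IsHomogeneous m) :
    IsHomogeneousSyzygy (powTriple q H) ![u * X 1 ^ q, -(u * X 0 ^ q), 0] (m + 2 * q) := by
  rw [isHomogeneousSyzygy_powTriple]
  have h1 := hu.mul ((isHomogeneous_X_pow (R := k) (1 : Fin 2) q).mul
    (isHomogeneous_X_pow (R := k) (0 : Fin 2) q))
  rw [two_mul]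
  refine ⟨by simp; ring, ?_, ?_, ?_⟩
  · simpa [mul_assoc] using h1
  · simpa [mul_assoc, mul_comm (X 1 ^ q : MvPolynomial (Fin 2) k)] using h1.neg
  · simpa using isHomogeneous_zero _ _ _

-- The syzygies `(y^q, -x^q, 0)` and `(0, H, -y^q)` have the independent values `(1, 0, 0)` and `(0,
-- H(0, 1), -1)`; `2q + h` bounds both degrees.
include hq hH in
theorem exists_finrank_valueSpace_powTriple :
    ∃ N, Module.finrank k (valueSpace (powTriple q H) N) = 2 := by
  refine ⟨2 * q + h, le_antisymm (finrank_valueSpace_powTriple_le hq _) ?_⟩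
  have hA : IsHomogeneousSyzygy (powTriple q H) ![1 * X 1 ^ q, -(1 * X 0 ^ q), 0] (0 + 2 * q) :=
    isHomogeneousSyzygy_koszul (isHomogeneous_one _ _)
  have hB : IsHomogeneousSyzygy (powTriple q H) ![0, H, - X 1 ^ q] (q + h) := by
    have h1 := (isHomogeneous_X_pow (R := k) (1 : Fin 2) q).mul hH
    rw [isHomogeneousSyzygy_powTriple]
    refine ⟨by simp; ring, ?_, ?_, ?_⟩
    · simpa using isHomogeneous_zero _ _ _
    · simpa [mul_comm] using h1
    · simpa using h1.neg
  have hA' := evalVec_mem_valueSpace hA (show 0 + 2 * q ≤ 2 * q + h by omega)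
  have hB' := evalVec_mem_valueSpace hB (show q + h ≤ 2 * q + h by omega)
  have hind : LinearIndependent k
      ![evalVec ![1 * X 1 ^ q, -(1 * X 0 ^ q), 0], evalVec ![0, H, - X 1 ^ q]] := by
    rw [LinearIndependent.pair_iff]
    intro s t hst
    have e0 := congrFun hst 0
    have e2 := congrFun hst 2
    simp at e0 e2
    exact ⟨e0, e2⟩
  have h2 := finrank_span_eq_card hind
  rw [Fintype.card_fin] at h2
  refine h2.symm.le.trans (Submodule.finrank_mono ?_)
  rw [Submodule.span_le]
  rintro _ ⟨i, rfl⟩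
  fin_cases i
  · exact hA'
  · exact hB'

include hq hH hH0 in
theorem exists_isGeneratingPair_powTriple :
    ∃ A B m₁ m₂, IsGeneratingPair (powTriple q H) A B m₁ m₂ :=
  exists_isGeneratingPair (powTriple_ne_zero hH0) (powTriple_isHomogeneous hH)
    (finrank_valueSpace_powTriple_le hq) (exists_finrank_valueSpace_powTriple hq hH)

/-- The ideal `(x^q, y^q)`. -/
noncomputable def powIdeal (k : Type*) [Field k] (q : ℕ) : Ideal (MvPolynomial (Fin 2) k) :=
  Ideal.span {X 0 ^ q, X 1 ^ q}

theorem mem_powIdeal {P : MvPolynomial (Fin 2) k} :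
    P ∈ powIdeal k q ↔ ∃ a b, a * X 0 ^ q + b * X 1 ^ q = P := Ideal.mem_span_pair

/-- Pigeonhole: exponents with sum at least `2q - 1` cannot both be below `q`. -/
theorem monomial_mem_powIdeal {m : Fin 2 →₀ ℕ} (hm : 2 * q ≤ m 0 + m 1 + 1) (c : k) :
    monomial m c ∈ powIdeal k q := by
  have e : monomial m c = C c * (X 0 ^ m 0 * X 1 ^ m 1) := by
    rw [monomial_eq, Finsupp.prod_fintype _ _ (by simp), Fin.prod_univ_two]
  rw [e]
  refine Ideal.mul_mem_left _ _ ?_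
  rcases le_or_gt q (m 0) with h1 | h1
  · exact Ideal.mul_mem_right _ _ (Ideal.mem_of_dvd _ (pow_dvd_pow _ h1)
      (Ideal.subset_span (Set.mem_insert _ _)))
  · exact Ideal.mul_mem_left _ _ (Ideal.mem_of_dvd _ (pow_dvd_pow _ (by omega : q ≤ m 1))
      (Ideal.subset_span (Set.mem_insert_of_mem _ rfl)))

theorem mem_powIdeal_of_isHomogeneous {P : MvPolynomial (Fin 2) k} {n : ℕ}
    (hP : P.IsHomogeneous n) (hn : 2 * q ≤ n + 1) : P ∈ powIdeal k q := by
  rw [← P.support_sum_monomial_coeff]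
  refine Ideal.sum_mem _ fun m hm => monomial_mem_powIdeal ?_ _
  have := hP (mem_support_iff.1 hm)
  simp only [Finsupp.weight_apply, Finsupp.sum_fintype, Fin.sum_univ_two, Pi.one_apply,
    smul_eq_mul, mul_one, implies_true] at this
  omega

theorem homogeneousComponent_mem_powIdeal {P : MvPolynomial (Fin 2) k} (hP : P ∈ powIdeal k q)
    (n : ℕ) : ∃ a b : MvPolynomial (Fin 2) k, (a * X 0 ^ q).IsHomogeneous n ∧
      (b * X 1 ^ q).IsHomogeneous n ∧
      a * X 0 ^ q + b * X 1 ^ q = homogeneousComponent n P := by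
  obtain ⟨a, b, rfl⟩ := mem_powIdeal.1 hP
  refine ⟨_, _, shiftedComponent_mul_isHomogeneous (isHomogeneous_X_pow _ _) a n,
    shiftedComponent_mul_isHomogeneous (isHomogeneous_X_pow _ _) b n, ?_⟩
  rw [map_add, homogeneousComponent_mul (isHomogeneous_X_pow _ _),
    homogeneousComponent_mul (isHomogeneous_X_pow _ _)]

/-- The ideal `(x^q, y^q) : H`. -/
noncomputable def colonIdeal (q : ℕ) (H : MvPolynomial (Fin 2) k) :
    Ideal (MvPolynomial (Fin 2) k) := (powIdeal k q).colon {H}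

theorem mem_colonIdeal {P : MvPolynomial (Fin 2) k} :
    P ∈ colonIdeal q H ↔ P * H ∈ powIdeal k q := by
  rw [colonIdeal, Submodule.mem_colon_singleton, smul_eq_mul]

/-- The homogeneous elements of degree `j` of `(x^q, y^q) : H`. -/
noncomputable def colonPiece (q : ℕ) (H : MvPolynomial (Fin 2) k) (j : ℕ) :
    Submodule k (MvPolynomial (Fin 2) k) :=
  homogeneousSubmodule (Fin 2) k j ⊓ (colonIdeal q H).restrictScalars k

include hH in
theorem homogeneousComponent_mem_colonPiece {P : MvPolynomial (Fin 2) k}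
    (hP : P ∈ colonIdeal q H) (j : ℕ) : homogeneousComponent j P ∈ colonPiece q H j := by
  refine ⟨homogeneousComponent_isHomogeneous _ _, ?_⟩
  obtain ⟨a, b, -, -, hab⟩ := homogeneousComponent_mem_powIdeal (mem_colonIdeal.1 hP) (j + h)
  rw [homogeneousComponent_mul hH, shiftedComponent_of_le (by omega), Nat.add_sub_cancel] at hab
  exact mem_colonIdeal.2 (mem_powIdeal.2 ⟨a, b, hab⟩)

/-- Projection to the third coordinate. -/
noncomputable def thirdCoord : (Fin 3 → MvPolynomial (Fin 2) k) →ₗ[k] MvPolynomial (Fin 2) k :=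
  LinearMap.proj 2

-- A polynomial is the third coordinate of a syzygy exactly when it multiplies `H` into `(x^q,
-- y^q)`; the degree of the syzygy exceeds that of the multiplier by `h`.
include hH hH0 in
theorem map_thirdCoord_syzygyPiece (j : ℕ) :
    (syzygyPiece (powTriple q H) (j + h)).map thirdCoord = colonPiece q H j := by
  ext P
  constructor
  · rintro ⟨A, hA, rfl⟩
    obtain ⟨h1, -, -, h2⟩ := isHomogeneousSyzygy_powTriple.1 hA
    refine ⟨isHomogeneous_of_mul hH hH0 h2, mem_colonIdeal.2 (mem_powIdeal.2 ⟨-A 0, -A 1, ?_⟩)⟩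
    change _ = A 2 * H
    linear_combination -h1
  · rintro ⟨hP, hP'⟩
    obtain ⟨a, b, ha, hb, hab⟩ := homogeneousComponent_mem_powIdeal (mem_colonIdeal.1 hP') (j + h)
    rw [homogeneousComponent_eq_self (IsHomogeneous.mul hP hH)] at hab
    refine ⟨![-a, -b, P], ?_, rfl⟩
    refine isHomogeneousSyzygy_powTriple.2 ⟨?_, ?_, ?_, IsHomogeneous.mul hP hH⟩
    · simp only [Matrix.cons_val]
      linear_combination -hab
    · simpa using ha.neg
    · simpa using hb.neg

include hH hH0 in
theorem map_thirdCoord_syzygyPiece_of_lt {n : ℕ} (hn : n < h) :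
    (syzygyPiece (powTriple q H) n).map thirdCoord = ⊥ := by
  rw [eq_bot_iff]
  rintro _ ⟨A, hA, rfl⟩
  rw [Submodule.mem_bot]
  have := eq_shiftedComponent hH hH0 (hA.2 2)
  rwa [shiftedComponent_of_lt hn] at this

theorem exists_koszul {A : Fin 3 → MvPolynomial (Fin 2) k}
    (hA : A ∈ syzygyModule (powTriple q H)) (h2 : A 2 = 0) :
    ∃ u, A = ![u * X 1 ^ q, -(u * X 0 ^ q), 0] := by
  have h1 := mem_syzygyModule_powTriple.1 hA
  rw [h2, zero_mul, add_zero] at h1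
  have hp : IsRelPrime (X 1 ^ q : MvPolynomial (Fin 2) k) (X 0 ^ q) := by
    refine IsRelPrime.pow ?_
    rw [Irreducible.isRelPrime_iff_not_dvd (X_prime (R := k) (i := (1 : Fin 2))).irreducible]
    intro hd
    have := map_dvd (aeval (![1, 0] : Fin 2 → k)) hd
    simp at this
  obtain ⟨u, hu⟩ : X 1 ^ q ∣ A 0 := by
    exact hp.dvd_of_dvd_mul_right ⟨-A 1, by linear_combination h1⟩
  refine ⟨u, funext fun i => ?_⟩
  fin_cases i
  · simp [hu, mul_comm]
  · refine mul_right_cancel₀ (pow_ne_zero q (X_ne_zero (R := k) (1 : Fin 2))) ?_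
    simp only [Fin.mk_one, Matrix.cons_val]
    linear_combination h1 - hu * X 0 ^ q
  · simpa using h2

/-- As `x^q` and `y^q` are coprime, the kernel consists of the `u • (y^q, -x^q, 0)` with `u` a form
of degree `n - 2q`. -/
theorem finrank_koszul (n : ℕ) :
    Module.finrank k (syzygyPiece (powTriple q H) n ⊓ LinearMap.ker thirdCoord : Submodule k _) =
      n + 1 - 2 * q := by
  let κ : MvPolynomial (Fin 2) k →ₗ[k] (Fin 3 → MvPolynomial (Fin 2) k) :=
    LinearMap.pi ![LinearMap.mulRight k (X 1 ^ q), LinearMap.mulRight k (-(X 0 ^ q)), 0]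
  have hκ : ∀ u, κ u = ![u * X 1 ^ q, -(u * X 0 ^ q), 0] := fun u => by
    ext1 i; fin_cases i <;> simp [κ]
  have hinj : Function.Injective κ := fun a b hab => by
    have := congrFun hab 0
    rw [hκ, hκ] at this
    exact mul_right_cancel₀ (pow_ne_zero q (X_ne_zero (R := k) (1 : Fin 2))) this
  have h2q : ((X 1 : MvPolynomial (Fin 2) k) ^ q * X 0 ^ q).IsHomogeneous (2 * q) := by
    rw [two_mul]
    exact (isHomogeneous_X_pow (R := k) (1 : Fin 2) q).mul
      (isHomogeneous_X_pow (R := k) (0 : Fin 2) q)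
  have hne : (X 1 : MvPolynomial (Fin 2) k) ^ q * X 0 ^ q ≠ 0 :=
    mul_ne_zero (pow_ne_zero _ (X_ne_zero _)) (pow_ne_zero _ (X_ne_zero _))
  have hmem : ∀ A ∈ (syzygyPiece (powTriple q H) n ⊓ LinearMap.ker thirdCoord : Submodule k _),
      ∃ u, A = κ u ∧ (u * (X 1 ^ q * X 0 ^ q)).IsHomogeneous n := by
    rintro A ⟨hA, hA2⟩
    obtain ⟨u, hu⟩ := exists_koszul hA.1 hA2
    refine ⟨u, by rw [hκ, hu], ?_⟩
    have := (isHomogeneousSyzygy_powTriple.1 hA).2.1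
    rwa [hu, Matrix.cons_val_zero, mul_assoc] at this
  rcases lt_or_ge n (2 * q) with hn | hn
  · rw [show (syzygyPiece (powTriple q H) n ⊓ LinearMap.ker thirdCoord : Submodule k _) = ⊥ from ?_,
      finrank_bot]
    · omega
    rw [eq_bot_iff]
    intro A hA
    obtain ⟨u, rfl, hu⟩ := hmem A hA
    have := eq_shiftedComponent h2q hne hu
    rw [shiftedComponent_of_lt hn] at this
    rw [this, map_zero]
    exact Submodule.zero_mem _
  · rw [show (syzygyPiece (powTriple q H) n ⊓ LinearMap.ker thirdCoord : Submodule k _) =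
        (homogeneousSubmodule (Fin 2) k (n - 2 * q)).map κ from ?_,
      ← LinearEquiv.finrank_eq (Submodule.equivMapOfInjective κ hinj _),
      (homogeneousSubmodule_finrank _).2]
    · omega
    refine le_antisymm ?_ ?_
    · intro A hA
      obtain ⟨u, rfl, hu⟩ := hmem A hA
      have := eq_shiftedComponent h2q hne hu
      rw [shiftedComponent_of_le hn] at this
      exact ⟨u, by rw [this]; exact homogeneousComponent_isHomogeneous _ _, rfl⟩
    · rintro _ ⟨u, hu, rfl⟩
      rw [hκ]
      refine ⟨?_, rfl⟩
      have := isHomogeneousSyzygy_koszul (q := q) (H := H) hu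
      rwa [Nat.sub_add_cancel hn] at this

include hH hH0 in
theorem finrank_syzygyPiece_eq (n : ℕ) : Module.finrank k (syzygyPiece (powTriple q H) n) =
    Module.finrank k ((syzygyPiece (powTriple q H) n).map thirdCoord) + (n + 1 - 2 * q) := by
  have := (syzygyPiece_finrank (powTriple_isHomogeneous (q := q) hH) (powTriple_ne_zero hH0) n).1
  have e := LinearMap.finrank_range_add_finrank_ker
    (thirdCoord.domRestrict (syzygyPiece (powTriple q H) n))
  rw [LinearMap.range_domRestrict, LinearMap.ker_domRestrict] at e
  rw [← e, ← finrank_koszul (q := q) (H := H) n]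
  congr 1
  have h3 := LinearEquiv.finrank_eq (Submodule.equivMapOfInjective
    (syzygyPiece (powTriple q H) n).subtype (Submodule.injective_subtype _)
    ((LinearMap.ker thirdCoord).submoduleOf (syzygyPiece (powTriple q H) n)))
  rw [Submodule.submoduleOf, Submodule.map_comap_subtype] at h3
  exact h3

theorem colonPiece_eq_of_le {j : ℕ} (hj : 2 * q ≤ j + 1) :
    colonPiece q H j = homogeneousSubmodule (Fin 2) k j := by
  refine inf_eq_left.2 fun P hP => ?_
  exact mem_colonIdeal.2 (Ideal.mul_mem_right _ _ (mem_powIdeal_of_isHomogeneous hP hj))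

section Pair

variable {A B : Fin 3 → MvPolynomial (Fin 2) k} {m₁ m₂ : ℕ}

include hq hH hH0

theorem IsGeneratingPair.finrank_colonPiece (hp : IsGeneratingPair (powTriple q H) A B m₁ m₂)
    (j : ℕ) : Module.finrank k (colonPiece q H j) + (j + h + 1 - 2 * q) =
      (j + h + 1 - m₁) + (j + h + 1 - m₂) := by
  rw [← hp.finrank_syzygyPiece (powTriple_isHomogeneous hH) (powTriple_ne_zero hH0)
    (exists_finrank_valueSpace_powTriple hq hH), finrank_syzygyPiece_eq hH hH0,
    map_thirdCoord_syzygyPiece hH hH0]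

/-- Below degree `h` the third coordinate vanishes and only Koszul syzygies remain. These degrees
complete the sum in `four_mul_finrank`. -/
theorem IsGeneratingPair.low_degree (hp : IsGeneratingPair (powTriple q H) A B m₁ m₂)
    {n : ℕ} (hn : n < h) : n + 1 - 2 * q = (n + 1 - m₁) + (n + 1 - m₂) := by
  rw [← hp.finrank_syzygyPiece (powTriple_isHomogeneous hH) (powTriple_ne_zero hH0)
    (exists_finrank_valueSpace_powTriple hq hH), finrank_syzygyPiece_eq hH hH0,
    map_thirdCoord_syzygyPiece_of_lt hH hH0 hn, finrank_bot, zero_add]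

theorem IsGeneratingPair.add_eq (hp : IsGeneratingPair (powTriple q H) A B m₁ m₂) :
    m₁ + m₂ = 2 * q + h := by
  -- In this large degree all forms lie in the colon ideal and no subtraction truncates.
  have := hp.finrank_colonPiece hq hH hH0 (2 * q + m₁ + m₂)
  rw [colonPiece_eq_of_le (by omega), (homogeneousSubmodule_finrank _).2] at this
  omega

end Pair

/-- The degree `j` part of the quotient by `(x^q, y^q) : H`. -/
def QuotientPiece (q : ℕ) (H : MvPolynomial (Fin 2) k) (j : ℕ) : Type _ :=
  homogeneousSubmodule (Fin 2) k j ⧸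
    (colonPiece q H j).submoduleOf (homogeneousSubmodule (Fin 2) k j)

noncomputable instance (j : ℕ) : AddCommGroup (QuotientPiece q H j) :=
  inferInstanceAs (AddCommGroup (homogeneousSubmodule (Fin 2) k j ⧸
    (colonPiece q H j).submoduleOf (homogeneousSubmodule (Fin 2) k j)))

noncomputable instance (j : ℕ) : Module k (QuotientPiece q H j) :=
  inferInstanceAs (Module k (homogeneousSubmodule (Fin 2) k j ⧸
    (colonPiece q H j).submoduleOf (homogeneousSubmodule (Fin 2) k j)))

instance (j : ℕ) : FiniteDimensional k (QuotientPiece q H j) :=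
  inferInstanceAs (FiniteDimensional k (homogeneousSubmodule (Fin 2) k j ⧸
    (colonPiece q H j).submoduleOf (homogeneousSubmodule (Fin 2) k j)))

/-- The projection from the forms of degree `j` to the degree `j` part of the quotient. -/
noncomputable def QuotientPiece.mk (q : ℕ) (H : MvPolynomial (Fin 2) k) (j : ℕ) :
    homogeneousSubmodule (Fin 2) k j →ₗ[k] QuotientPiece q H j :=
  Submodule.mkQ ((colonPiece q H j).submoduleOf (homogeneousSubmodule (Fin 2) k j))

theorem QuotientPiece.mk_surjective (j : ℕ) :
    Function.Surjective (QuotientPiece.mk q H j) := Submodule.mkQ_surjective _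

theorem QuotientPiece.mk_eq_zero {j : ℕ} {P : homogeneousSubmodule (Fin 2) k j} :
    QuotientPiece.mk q H j P = 0 ↔ (P : MvPolynomial (Fin 2) k) ∈ colonPiece q H j :=
  Submodule.Quotient.mk_eq_zero _

theorem QuotientPiece.finrank_add (j : ℕ) :
    Module.finrank k (QuotientPiece q H j) + Module.finrank k (colonPiece q H j) = j + 1 := by
  rw [← (homogeneousSubmodule_finrank (k := k) j).2]
  have h3 := LinearEquiv.finrank_eq (Submodule.equivMapOfInjective
    (homogeneousSubmodule (Fin 2) k j).subtype (Submodule.injective_subtype _)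
    ((colonPiece q H j).submoduleOf (homogeneousSubmodule (Fin 2) k j)))
  rw [Submodule.submoduleOf, Submodule.map_comap_subtype,
    inf_eq_right.2 (show colonPiece q H j ≤ _ from inf_le_left)] at h3
  rw [← h3]
  exact Submodule.finrank_quotient_add_finrank _

/-- The map to the product of the graded pieces of the quotient by `(x^q, y^q) : H`. -/
noncomputable def colonQuotientMap (q : ℕ) (H : MvPolynomial (Fin 2) k) :
    MvPolynomial (Fin 2) k →ₗ[k] ((j : Fin (2 * q)) → QuotientPiece q H j) :=
  LinearMap.pi fun j => (QuotientPiece.mk q H j).comp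
    ((homogeneousComponent (j : ℕ)).codRestrict _ fun P => homogeneousComponent_mem _ P)

theorem colonQuotientMap_surjective : Function.Surjective (colonQuotientMap (k := k) q H) := by
  intro y
  choose z hz using fun j : Fin (2 * q) => QuotientPiece.mk_surjective (j : ℕ) (y j)
  refine ⟨∑ j, (z j : MvPolynomial (Fin 2) k), funext fun j => ?_⟩
  rw [← hz j, colonQuotientMap, LinearMap.pi_apply, LinearMap.comp_apply]
  congr 1
  refine Subtype.ext ?_
  change homogeneousComponent (j : ℕ) (∑ j, (z j : MvPolynomial (Fin 2) k)) = _
  rw [map_sum, Finset.sum_eq_single j]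
  · exact homogeneousComponent_eq_self (z j).2
  · intro i _ hij
    rw [homogeneousComponent_of_mem (z i).2, if_neg]
    exact fun hc => hij (Fin.ext hc.symm)
  · simp

-- Finitely many pieces suffice because every form of degree at least `2q` already lies in `(x^q,
-- y^q)`.
include hH in
theorem ker_colonQuotientMap :
    LinearMap.ker (colonQuotientMap q H) = (colonIdeal q H).restrictScalars k := by
  ext P
  have e : P ∈ LinearMap.ker (colonQuotientMap q H) ↔
      ∀ j : Fin (2 * q), homogeneousComponent j P ∈ colonPiece q H j := by
    rw [LinearMap.mem_ker, funext_iff]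
    refine forall_congr' fun j => ?_
    rw [colonQuotientMap, LinearMap.pi_apply, LinearMap.comp_apply, Pi.zero_apply,
      QuotientPiece.mk_eq_zero]
    rfl
  rw [e]
  constructor
  · intro hj
    change P ∈ colonIdeal q H
    rw [← sum_homogeneousComponent P]
    refine Ideal.sum_mem _ fun i _ => ?_
    rcases lt_or_ge i (2 * q) with hi | hi
    · exact (hj ⟨i, hi⟩).2
    · exact mem_colonIdeal.2 (Ideal.mul_mem_right _ _
        (mem_powIdeal_of_isHomogeneous (homogeneousComponent_isHomogeneous i P) (by omega)))
  · exact fun hP j => homogeneousComponent_mem_colonPiece hH hP j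

theorem finrank_quotient_of_surjective_pi {V ι : Type*} [Fintype ι] {W : ι → Type*}
    [AddCommGroup V] [Module k V] [∀ i, AddCommGroup (W i)] [∀ i, Module k (W i)]
    [∀ i, FiniteDimensional k (W i)] (φ : V →ₗ[k] (∀ i, W i)) (hφ : Function.Surjective φ)
    (N : Submodule k V) (hN : LinearMap.ker φ = N) :
    FiniteDimensional k (V ⧸ N) ∧
      Module.finrank k (V ⧸ N) = ∑ i, Module.finrank k (W i) := by
  subst hN
  have e := φ.quotKerEquivOfSurjective hφ
  exact ⟨Module.Finite.equiv e.symm, by rw [e.finrank_eq, Module.finrank_pi_fintype]⟩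

include hH in
theorem finrank_quotient_colonIdeal :
    FiniteDimensional k (MvPolynomial (Fin 2) k ⧸ colonIdeal q H) ∧
    Module.finrank k (MvPolynomial (Fin 2) k ⧸ colonIdeal q H) +
      ∑ j ∈ Finset.range (2 * q), Module.finrank k (colonPiece q H j) =
      ∑ j ∈ Finset.range (2 * q), (j + 1) := by
  obtain ⟨hfin, hrank⟩ := finrank_quotient_of_surjective_pi (W := fun j : Fin (2 * q) =>
    QuotientPiece q H j) (colonQuotientMap q H) colonQuotientMap_surjective
    ((colonIdeal q H).restrictScalars k) (ker_colonQuotientMap hH)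
  have e := Submodule.Quotient.restrictScalarsEquiv k (colonIdeal q H)
  refine ⟨Module.Finite.equiv e, ?_⟩
  rw [← e.finrank_eq, hrank, Finset.sum_range, Finset.sum_range, ← Finset.sum_add_distrib]
  exact Finset.sum_congr rfl fun j _ => QuotientPiece.finrank_add _

theorem two_mul_sum_sub (L m : ℕ) :
    2 * ∑ n ∈ Finset.range L, (n + 1 - m) = (L - m) * (L - m + 1) := by
  induction L with
  | zero => simp
  | succ L ih =>
    rw [Finset.sum_range_succ, mul_add, ih]
    rcases le_or_gt m L with hm | hm
    · obtain ⟨c, rfl⟩ := Nat.exists_eq_add_of_le hm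
      rw [show m + c + 1 - m = c + 1 by omega, show m + c - m = c by omega]
      ring
    · rw [show L - m = 0 by omega]
      rcases Nat.lt_or_ge (L + 1) m with h' | h'
      · rw [show L + 1 - m = 0 by omega]
      · rw [show L + 1 - m = 0 by omega]

-- Adding up the dimension formulas over all degrees below `h + 2q` yields triangular numbers. Since
-- `h + 2q` is the sum of the two generator degrees, removing `2q` or one of these degrees leaves
-- `h` or the other degree.
include hq hH hH0 in
theorem IsGeneratingPair.four_mul_finrank {A B : Fin 3 → MvPolynomial (Fin 2) k} {m δ : ℕ}
    (hp : IsGeneratingPair (powTriple q H) A B (m + δ) m) :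
    4 * Module.finrank k (MvPolynomial (Fin 2) k ⧸ colonIdeal q H) + 4 * q * h + δ ^ 2 =
      4 * q ^ 2 + h ^ 2 := by
  have hadd := hp.add_eq hq hH hH0
  have h1 := (finrank_quotient_colonIdeal (q := q) hH).2
  have h2 : ∑ j ∈ Finset.range (2 * q), Module.finrank k (colonPiece q H j) +
      ∑ n ∈ Finset.range (h + 2 * q), (n + 1 - 2 * q) =
      ∑ n ∈ Finset.range (h + 2 * q), (n + 1 - (m + δ)) +
      ∑ n ∈ Finset.range (h + 2 * q), (n + 1 - m) := by
    rw [← Finset.sum_add_distrib, Finset.sum_range_add, Finset.sum_range_add, add_left_comm,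
      ← Finset.sum_add_distrib]
    congr 1
    · exact Finset.sum_congr rfl fun n hn =>
        hp.low_degree hq hH hH0 (Finset.mem_range.1 hn)
    · refine Finset.sum_congr rfl fun j _ => ?_
      have := hp.finrank_colonPiece hq hH hH0 j
      rwa [add_comm h j]
  have s0 := two_mul_sum_sub (2 * q) 0
  have s1 := two_mul_sum_sub (h + 2 * q) (2 * q)
  have s2 := two_mul_sum_sub (h + 2 * q) (m + δ)
  have s3 := two_mul_sum_sub (h + 2 * q) m
  simp only [Nat.sub_zero] at s0
  rw [show h + 2 * q - 2 * q = h by omega] at s1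
  rw [show h + 2 * q - (m + δ) = m by omega] at s2
  rw [show h + 2 * q - m = m + δ by omega] at s3
  zify at *
  have hh : (h : ℤ) = 2 * m + δ - 2 * q := by linarith
  rw [hh] at *
  nlinarith

end Triple

/-! ### The gap under multiplication by a form and under Frobenius -/

section Compare

variable {q h : ℕ} (hq : 0 < q) {H : MvPolynomial (Fin 2) k} (hH : H.IsHomogeneous h)
  (hH0 : H ≠ 0) {A B : Fin 3 → MvPolynomial (Fin 2) k} {m₁ m₂ : ℕ}

include hH0 in
theorem IsGeneratingPair.le_of_ne_zero (hp : IsGeneratingPair (powTriple q H) A B m₁ m₂)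
    {z : Fin 3 → MvPolynomial (Fin 2) k} {n : ℕ} (hz : IsHomogeneousSyzygy (powTriple q H) z n)
    (hz0 : z ≠ 0) : m₂ ≤ n := by
  by_contra hn
  have h1 := hp.syzygyPiece_eq_bot (powTriple_ne_zero hH0) (not_le.1 hn)
  exact hz0 ((Submodule.mem_bot k).1 (h1 ▸ (mem_syzygyPiece.2 hz)))

include hq hH hH0

theorem IsGeneratingPair.linearIndependent (hp : IsGeneratingPair (powTriple q H) A B m₁ m₂) :
    LinearIndependent k ![evalVec A, evalVec B] := by
  rw [linearIndependent_iff_card_eq_finrank_span, Matrix.range_cons, Matrix.range_cons,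
    Matrix.range_empty, Set.union_empty, Set.singleton_union, Set.finrank,
    hp.finrank_span (powTriple_ne_zero hH0) (exists_finrank_valueSpace_powTriple hq hH),
    Fintype.card_fin]

theorem IsGeneratingPair.right_ne_zero (hp : IsGeneratingPair (powTriple q H) A B m₁ m₂) :
    B ≠ 0 := by
  rintro rfl
  have := (hp.linearIndependent hq hH hH0).ne_zero 1
  simp at this

theorem IsGeneratingPair.le_of_linearIndependent
    (hp : IsGeneratingPair (powTriple q H) A B m₁ m₂) {n : ℕ} {v w : Fin 3 → k}
    (hv : v ∈ valueSpace (powTriple q H) n) (hw : w ∈ valueSpace (powTriple q H) n)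
    (hvw : LinearIndependent k ![v, w]) : m₁ ≤ n := by
  have h1 := finrank_span_eq_card hvw
  have h2 : Submodule.span k (Set.range ![v, w]) ≤ valueSpace (powTriple q H) n := by
    rw [Submodule.span_le]
    rintro _ ⟨i, rfl⟩
    fin_cases i
    · exact hv
    · exact hw
  have h3 := Submodule.finrank_mono h2
  rw [h1, Fintype.card_fin, hp.finrank_valueSpace (powTriple_ne_zero hH0)
    (exists_finrank_valueSpace_powTriple hq hH)] at h3
  by_contra hc
  rw [if_neg hc] at h3
  split_ifs at h3 <;> omega

end Compare

/-- The syzygy gap of `(x^q, y^q, H)`. -/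
noncomputable def gap (q : ℕ) (H : MvPolynomial (Fin 2) k) : ℕ :=
  sInf {d | IsSyzygyGap (powTriple q H) d}

section Gap

variable {q h : ℕ} (hq : 0 < q) {H : MvPolynomial (Fin 2) k} (hH : H.IsHomogeneous h)
  (hH0 : H ≠ 0)

include hq hH hH0

theorem existsUnique_isSyzygyGap : ∃! d, IsSyzygyGap (powTriple q H) d := by
  obtain ⟨A, B, m₁, m₂, hp⟩ := exists_isGeneratingPair_powTriple hq hH hH0
  refine ⟨m₁ - m₂, isSyzygyGap_iff.2 ⟨A, B, m₁, m₂, hp, by have := hp.le; omega⟩, ?_⟩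
  intro d hd
  obtain ⟨A', B', n₁, n₂, hp', e⟩ := isSyzygyGap_iff.1 hd
  obtain ⟨e₁, e₂⟩ := hp.degrees_unique (powTriple_ne_zero hH0)
    (exists_finrank_valueSpace_powTriple hq hH) hp'
  omega

theorem isSyzygyGap_gap : IsSyzygyGap (powTriple q H) (gap q H) :=
  Nat.sInf_mem (existsUnique_isSyzygyGap hq hH hH0).exists

theorem eq_gap {d : ℕ} (hd : IsSyzygyGap (powTriple q H) d) : d = gap q H :=
  (existsUnique_isSyzygyGap hq hH hH0).unique hd (isSyzygyGap_gap hq hH hH0)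

theorem exists_isGeneratingPair_gap :
    ∃ A B m, IsGeneratingPair (powTriple q H) A B (m + gap q H) m := by
  obtain ⟨A, B, m₁, m₂, hp, e⟩ := isSyzygyGap_iff.1 (isSyzygyGap_gap hq hH hH0)
  exact ⟨A, B, m₂, e ▸ hp⟩

theorem four_mul_finrank_add_gap :
    4 * Module.finrank k (MvPolynomial (Fin 2) k ⧸ colonIdeal q H) + 4 * q * h + gap q H ^ 2 =
      4 * q ^ 2 + h ^ 2 := by
  obtain ⟨A, B, m, hp⟩ := exists_isGeneratingPair_gap hq hH hH0
  exact hp.four_mul_finrank hq hH hH0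

/-- The minimal degrees satisfy `m ≤ m' ≤ m + r`: move `g` into the third coordinate, or multiply
the first two by `g`. The degree sums `2q + h` and `2q + h + r` then control the gaps. -/
theorem gap_mul_le {g : MvPolynomial (Fin 2) k} {r : ℕ} (hg : g.IsHomogeneous r) (hg0 : g ≠ 0) :
    gap q H ≤ gap q (H * g) + r ∧ gap q (H * g) ≤ gap q H + r := by
  have hHg := hH.mul hg
  have hHg0 := mul_ne_zero hH0 hg0
  obtain ⟨A, B, m, hp⟩ := exists_isGeneratingPair_gap hq hH hH0
  obtain ⟨A', B', m', hp'⟩ := exists_isGeneratingPair_gap hq hHg hHg0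
  have e := hp.add_eq hq hH hH0
  have e' := hp'.add_eq hq hHg hHg0
  have h1 : m' ≤ m + r := by
    obtain ⟨b, b0, b1, b2⟩ := isHomogeneousSyzygy_powTriple.1 hp.right
    refine hp'.le_of_ne_zero hHg0 (z := ![g * B 0, g * B 1, B 2]) ?_ ?_
    · rw [isHomogeneousSyzygy_powTriple, add_comm m r]
      refine ⟨?_, ?_, ?_, ?_⟩
      · simp only [Matrix.cons_val]
        linear_combination g * b
      · simpa [mul_assoc] using hg.mul b0
      · simpa [mul_assoc] using hg.mul b1
      · simpa [mul_left_comm, mul_comm, mul_assoc] using hg.mul b2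
    · intro hz
      refine hp.right_ne_zero hq hH hH0 (funext fun i => ?_)
      have z0 := congrFun hz 0
      have z1 := congrFun hz 1
      have z2 := congrFun hz 2
      simp [hg0] at z0 z1 z2
      fin_cases i <;> simpa
  have h2 : m ≤ m' := by
    obtain ⟨b, b0, b1, b2⟩ := isHomogeneousSyzygy_powTriple.1 hp'.right
    refine hp.le_of_ne_zero hH0 (z := ![B' 0, B' 1, B' 2 * g]) ?_ ?_
    · rw [isHomogeneousSyzygy_powTriple]
      refine ⟨?_, b0, b1, ?_⟩
      · simp only [Matrix.cons_val]
        linear_combination b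
      · simpa [mul_assoc, mul_comm g] using b2
    · intro hz
      refine hp'.right_ne_zero hq hHg hHg0 (funext fun i => ?_)
      have z0 := congrFun hz 0
      have z1 := congrFun hz 1
      have z2 := congrFun hz 2
      simp [hg0] at z0 z1 z2
      fin_cases i <;> simpa
  omega

end Gap

theorem isHomogeneousSyzygy_pow_char {p : ℕ} [Fact p.Prime] [CharP k p] {q : ℕ}
    {H : MvPolynomial (Fin 2) k} {A : Fin 3 → MvPolynomial (Fin 2) k} {n : ℕ}
    (hA : IsHomogeneousSyzygy (powTriple q H) A n) :
    IsHomogeneousSyzygy (powTriple (q * p) (H ^ p)) (fun i => A i ^ p) (n * p) := by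
  obtain ⟨b, b0, b1, b2⟩ := isHomogeneousSyzygy_powTriple.1 hA
  refine isHomogeneousSyzygy_powTriple.2 ⟨?_, ?_, ?_, ?_⟩
  · simp only [pow_mul, ← mul_pow, ← add_pow_char]
    rw [b, zero_pow (Fact.out : p.Prime).ne_zero]
  · simpa [pow_mul, mul_pow] using b0.pow p
  · simpa [pow_mul, mul_pow] using b1.pow p
  · simpa [pow_mul, mul_pow] using b2.pow p

/-- Over a perfect field the coefficients of a relation are `p`-th powers, so the relation is the
`p`-th power of one between `v` and `w`. -/
theorem linearIndependent_pair_pow {p : ℕ} [Fact p.Prime] [CharP k p] [PerfectField k]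
    {v w : Fin 3 → k} (h : LinearIndependent k ![v, w]) :
    LinearIndependent k ![fun i => v i ^ p, fun i => w i ^ p] := by
  rw [LinearIndependent.pair_iff] at h ⊢
  intro s t hst
  obtain ⟨s, rfl⟩ := surjective_frobenius k p s
  obtain ⟨t, rfl⟩ := surjective_frobenius k p t
  have := h s t (funext fun i => by
    have := congrFun hst i
    simp only [frobenius_def, Pi.add_apply, Pi.smul_apply, smul_eq_mul, Pi.zero_apply, ← mul_pow,
      ← add_pow_char] at this
    simpa using eq_zero_of_pow_eq_zero this)
  have hp := (Fact.out : p.Prime).ne_zero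
  simp [this.1, this.2, frobenius_def, hp]

/-- The `p`-th powers of the generators bound both new degrees by `p` times the old ones. The degree
sum is also multiplied by `p`, so both bounds are equalities. -/
theorem gap_frobenius {p : ℕ} [Fact p.Prime] [CharP k p] [PerfectField k] {q h : ℕ} (hq : 0 < q)
    {H : MvPolynomial (Fin 2) k} (hH : H.IsHomogeneous h) (hH0 : H ≠ 0) :
    gap (q * p) (H ^ p) = gap q H * p := by
  have hp0 : 0 < p := (Fact.out : p.Prime).pos
  have hqp : 0 < q * p := Nat.mul_pos hq hp0
  have hHp := hH.pow p
  have hHp0 := pow_ne_zero p hH0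
  obtain ⟨A, B, m, hp⟩ := exists_isGeneratingPair_gap hq hH hH0
  obtain ⟨A', B', m', hp'⟩ := exists_isGeneratingPair_gap hqp hHp hHp0
  have e := hp.add_eq hq hH hH0
  have e' := hp'.add_eq hqp hHp hHp0
  have hA := isHomogeneousSyzygy_pow_char (p := p) hp.left
  have hB := isHomogeneousSyzygy_pow_char (p := p) hp.right
  have h1 : m' ≤ m * p := hp'.le_of_ne_zero hHp0 hB fun hz =>
    hp.right_ne_zero hq hH hH0 (funext fun i => eq_zero_of_pow_eq_zero (congrFun hz i))
  have h2 : m' + gap (q * p) (H ^ p) ≤ (m + gap q H) * p := by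
    refine hp'.le_of_linearIndependent hqp hHp hHp0 (evalVec_mem_valueSpace hA le_rfl)
      (evalVec_mem_valueSpace hB (Nat.mul_le_mul_right _ hp.le)) ?_
    convert linearIndependent_pair_pow (p := p) (hp.linearIndependent hq hH hH0) using 2
    · ext i; simp
    · congr 1
      ext i; simp
  have h3 : (m + gap q H + m) * p = (2 * q + h) * p := by rw [e]
  nlinarith

/-! ### The continuous function `δ_f` -/

section GapFunction

variable {r : ℕ} {f : MvPolynomial (Fin 2) k} (hf : f.IsHomogeneous r) (hf0 : f ≠ 0)

include hf hf0

theorem gap_pow_le {q : ℕ} (hq : 0 < q) (a n : ℕ) :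
    gap q (f ^ a) ≤ gap q (f ^ (a + n)) + r * n ∧ gap q (f ^ (a + n)) ≤ gap q (f ^ a) + r * n := by
  induction n with
  | zero => simp
  | succ n ih =>
    have := gap_mul_le hq (hf.pow (a + n)) (pow_ne_zero (a + n) hf0) hf hf0
    rw [← pow_succ, add_assoc] at this
    rw [mul_add, mul_one]
    omega

theorem abs_gap_pow_sub_le {q : ℕ} (hq : 0 < q) (a b : ℕ) :
    |(gap q (f ^ a) : ℝ) - gap q (f ^ b)| ≤ r * |(a : ℝ) - b| := by
  wlog hab : a ≤ b generalizing a b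
  · rw [abs_sub_comm, abs_sub_comm (a : ℝ)]
    exact this b a (by omega)
  obtain ⟨n, rfl⟩ := Nat.exists_eq_add_of_le hab
  obtain ⟨h1, h2⟩ := gap_pow_le hf hf0 hq a n
  have h1' : (gap q (f ^ a) : ℝ) ≤ gap q (f ^ (a + n)) + r * n := by exact_mod_cast h1
  have h2' : (gap q (f ^ (a + n)) : ℝ) ≤ gap q (f ^ a) + r * n := by exact_mod_cast h2
  have : |(a : ℝ) - ((a + n : ℕ) : ℝ)| = n := by
    push_cast
    rw [sub_add_cancel_left, abs_neg, Nat.abs_cast]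
  rw [this, abs_le]
  constructor <;> linarith

variable (p : ℕ) [Fact p.Prime] [CharP k p] [PerfectField k]

theorem gap_pow_add (e j a : ℕ) :
    gap (p ^ (e + j)) (f ^ (a * p ^ j)) = gap (p ^ e) (f ^ a) * p ^ j := by
  induction j with
  | zero => simp
  | succ j ih =>
    rw [← add_assoc, pow_succ, pow_succ, ← mul_assoc, pow_mul,
      gap_frobenius (pow_pos (Fact.out : p.Prime).pos _) (hf.pow _) (pow_ne_zero _ hf0), ih,
      mul_assoc]

/-- Frobenius scaling brings both fractions to the denominator `p^(e + e')`, where each extra factor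
`f` costs at most `r`. -/
theorem abs_gap_div_sub_le (e e' a a' : ℕ) :
    |(gap (p ^ e) (f ^ a) : ℝ) / (p : ℝ) ^ e - gap (p ^ e') (f ^ a') / (p : ℝ) ^ e'| ≤
      r * |(a : ℝ) / (p : ℝ) ^ e - a' / (p : ℝ) ^ e'| := by
  have hp : (0 : ℝ) < p := by exact_mod_cast (Fact.out : p.Prime).pos
  have h1 := gap_pow_add hf hf0 p e e' a
  have h2 := gap_pow_add hf hf0 p e' e a'
  have h3 := abs_gap_pow_sub_le hf hf0 (pow_pos (Fact.out : p.Prime).pos (e + e'))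
    (a * p ^ e') (a' * p ^ e)
  rw [h1, add_comm e e', h2] at h3
  push_cast at h3
  have key : ∀ x y : ℝ, x / (p : ℝ) ^ e - y / (p : ℝ) ^ e' =
      (x * p ^ e' - y * p ^ e) / (p ^ e * p ^ e') := fun x y => by
    field_simp
  have hpos : (0 : ℝ) < p ^ e * p ^ e' := by positivity
  rw [key, key, abs_div, abs_div, abs_of_pos hpos, ← mul_div_assoc]
  exact div_le_div_of_nonneg_right h3 hpos.le

theorem exists_gapFunction : ∃ δ : C(ℝ≥0, ℝ), LipschitzWith r δ ∧
    ∀ e a : ℕ, δ ((a : ℝ≥0) / (p : ℝ≥0) ^ e) = gap (p ^ e) (f ^ a) / (p : ℝ) ^ e := by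
  classical
  let s : Set ℝ≥0 := {x | ∃ ea : ℕ × ℕ, x = (ea.2 : ℝ≥0) / (p : ℝ≥0) ^ ea.1}
  let g : ℝ≥0 → ℝ := fun x => if hx : x ∈ s then
    gap (p ^ hx.choose.1) (f ^ hx.choose.2) / (p : ℝ) ^ hx.choose.1 else 0
  have hcmp : ∀ x (hx : x ∈ s), ∃ ea : ℕ × ℕ, x = (ea.2 : ℝ≥0) / (p : ℝ≥0) ^ ea.1 ∧
      g x = gap (p ^ ea.1) (f ^ ea.2) / (p : ℝ) ^ ea.1 := fun x hx =>
    ⟨hx.choose, hx.choose_spec, dif_pos hx⟩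
  have hlip : LipschitzOnWith r g s := by
    refine LipschitzOnWith.of_dist_le_mul fun x hx y hy => ?_
    obtain ⟨⟨e, a⟩, rfl, h1⟩ := hcmp x hx
    obtain ⟨⟨e', a'⟩, rfl, h2⟩ := hcmp y hy
    rw [h1, h2, Real.dist_eq, NNReal.dist_eq]
    push_cast
    exact abs_gap_div_sub_le hf hf0 p e e' a a'
  obtain ⟨δ, hδ, hδs⟩ := hlip.extend_real
  refine ⟨⟨δ, hδ.continuous⟩, hδ, fun e a => ?_⟩
  have hx : (a : ℝ≥0) / (p : ℝ≥0) ^ e ∈ s := ⟨(e, a), rfl⟩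
  obtain ⟨⟨e', a'⟩, h1, h2⟩ := hcmp _ hx
  rw [ContinuousMap.coe_mk, ← hδs hx, h2]
  -- Independence of the chosen representation of the fraction is the Lipschitz estimate at distance
  -- zero.
  have h3 := abs_gap_div_sub_le hf hf0 p e' e a' a
  have h4 : (a : ℝ) / (p : ℝ) ^ e = a' / (p : ℝ) ^ e' := by
    have := congrArg NNReal.toReal h1
    push_cast at this
    exact this
  rw [h4, sub_self, abs_zero, mul_zero] at h3
  exact sub_eq_zero.1 (abs_nonpos_iff.1 h3)

end GapFunction

theorem tendsto_ceil_div {p : ℕ} (hp : 1 < p) (t : ℝ≥0) :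
    Tendsto (fun e : ℕ => ((⌈(t : ℝ) * ((p : ℝ) ^ e - 1)⌉₊ : ℝ≥0) / (p : ℝ≥0) ^ e)) atTop
      (𝓝 t) := by
  rw [← NNReal.tendsto_coe]
  push_cast
  have hp' : (1 : ℝ) < p := by exact_mod_cast hp
  have h0 : Tendsto (fun e : ℕ => ((p : ℝ) ^ e)⁻¹) atTop (𝓝 0) :=
    (tendsto_pow_atTop_atTop_of_one_lt hp').inv_tendsto_atTop
  have hlow : Tendsto (fun e : ℕ => (t : ℝ) - t * ((p : ℝ) ^ e)⁻¹) atTop (𝓝 t) := by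
    simpa using tendsto_const_nhds.sub (h0.const_mul (t : ℝ))
  have hup : Tendsto (fun e : ℕ => (t : ℝ) + ((p : ℝ) ^ e)⁻¹) atTop (𝓝 t) := by
    simpa using tendsto_const_nhds.add h0
  refine tendsto_of_tendsto_of_tendsto_of_le_of_le hlow hup (fun e => ?_) fun e => ?_
  · have hq : (0 : ℝ) < (p : ℝ) ^ e := by positivity
    have := Nat.le_ceil ((t : ℝ) * ((p : ℝ) ^ e - 1))
    simp only
    rw [le_div_iff₀ hq, sub_mul, mul_assoc, inv_mul_cancel₀ hq.ne']
    linarith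
  · have hq : (0 : ℝ) < (p : ℝ) ^ e := by positivity
    have hq1 : (1 : ℝ) ≤ (p : ℝ) ^ e := one_le_pow₀ hp'.le
    have := Nat.ceil_lt_add_one (mul_nonneg t.2 (sub_nonneg.2 hq1) :
      (0 : ℝ) ≤ t * ((p : ℝ) ^ e - 1))
    have ht : (0 : ℝ) ≤ t := t.2
    simp only
    rw [div_le_iff₀ hq, add_mul, inv_mul_cancel₀ hq.ne']
    linarith

theorem eq_of_eq_on_fractions {p : ℕ} (hp : 1 < p) {δ δ' : C(ℝ≥0, ℝ)}
    (h : ∀ e a : ℕ, δ' ((a : ℝ≥0) / (p : ℝ≥0) ^ e) = δ ((a : ℝ≥0) / (p : ℝ≥0) ^ e)) :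
    δ' = δ := by
  ext t
  have h1 := (δ.continuous.tendsto t).comp (tendsto_ceil_div hp t)
  have h2 := (δ'.continuous.tendsto t).comp (tendsto_ceil_div hp t)
  refine tendsto_nhds_unique h2 (h1.congr fun e => ?_)
  exact (h _ _).symm

/-! ### Length over a local ring with residue field `k`, and the dimension of `k[x, y]_⟨x, y⟩` -/

section Length

variable {R : Type*} [CommRing R] [IsLocalRing R] [Algebra k R]

theorem length_residue_eq_one
    (hres : ∀ x : R, ∃ c : k, x - algebraMap k R c ∈ IsLocalRing.maximalIdeal R) :
    Module.length k (R ⧸ IsLocalRing.maximalIdeal R) = 1 := by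
  have hs : Function.Surjective (Algebra.linearMap k (R ⧸ IsLocalRing.maximalIdeal R)) := by
    intro y
    obtain ⟨x, rfl⟩ := Ideal.Quotient.mk_surjective y
    obtain ⟨c, hc⟩ := hres x
    exact ⟨c, ((Ideal.Quotient.eq).2 hc).symm⟩
  have hi : Function.Injective (Algebra.linearMap k (R ⧸ IsLocalRing.maximalIdeal R)) := by
    have : Nontrivial (R ⧸ IsLocalRing.maximalIdeal R) :=
      Ideal.Quotient.nontrivial_iff.2 (IsLocalRing.maximalIdeal.isMaximal R).ne_top
    exact (algebraMap k (R ⧸ IsLocalRing.maximalIdeal R)).injective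
  rw [← (LinearEquiv.ofBijective _ ⟨hi, hs⟩).length_eq, Module.length_eq_one]

/-- Along a composition series every simple factor is the residue field, which has length 1 over
`k`. -/
theorem length_eq_length_of_isFiniteLength
    (hres : ∀ x : R, ∃ c : k, x - algebraMap k R c ∈ IsLocalRing.maximalIdeal R)
    {M : Type*} [AddCommGroup M] [Module R M] (hM : IsFiniteLength R M) :
    ∀ [Module k M] [IsScalarTower k R M], Module.length R M = Module.length k M := by
  induction hM with
  | of_subsingleton => intro _ _; rw [Module.length_eq_zero, Module.length_eq_zero]
  | @of_simple_quotient M _ _ N hsimple hN ih =>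
    intro _ _
    rw [Module.length_eq_add_of_exact N.subtype N.mkQ N.injective_subtype N.mkQ_surjective
        (LinearMap.exact_subtype_mkQ N),
      Module.length_eq_add_of_exact (N.subtype.restrictScalars k) (N.mkQ.restrictScalars k)
        N.injective_subtype N.mkQ_surjective (LinearMap.exact_subtype_mkQ N), ih]
    congr 1
    obtain ⟨I, hI, ⟨e⟩⟩ := isSimpleModule_iff_quot_maximal.1 hsimple
    rw [Module.length_eq_one, (e.restrictScalars k).length_eq, IsLocalRing.eq_maximalIdeal hI,
      length_residue_eq_one hres]

theorem length_eq_finrank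
    (hres : ∀ x : R, ∃ c : k, x - algebraMap k R c ∈ IsLocalRing.maximalIdeal R)
    {M : Type*} [AddCommGroup M] [Module R M] [Module k M] [IsScalarTower k R M]
    [FiniteDimensional k M] : Module.length R M = Module.finrank k M := by
  have h1 : IsNoetherian R M := isNoetherian_of_tower k inferInstance
  have h2 : IsArtinian R M := isArtinian_of_tower k inferInstance
  rw [length_eq_length_of_isFiniteLength (k := k) hres
    (isFiniteLength_iff_isNoetherian_isArtinian.2 ⟨h1, h2⟩), Module.length_eq_finrank]

end Length

theorem mem_originIdeal {P : MvPolynomial (Fin 2) k} :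
    P ∈ originIdeal k ↔ constantCoeff P = 0 := by
  rw [originIdeal_eq_ker, RingHom.mem_ker]

section Dimension

theorem height_originIdeal : (originIdeal k).height = 2 := by
  refine le_antisymm ?_ ?_
  · refine (Ideal.height_le_spanFinrank _ (originIdeal_isPrime k).ne_top).trans ?_
    have h1 := Submodule.spanFinrank_span_le_ncard_of_finite (R := MvPolynomial (Fin 2) k)
      (Set.toFinite ({X 0, X 1} : Set (MvPolynomial (Fin 2) k)))
    have h2 := Set.ncard_insert_le (X 0 : MvPolynomial (Fin 2) k) {X 1}
    rw [Set.ncard_singleton] at h2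
    exact_mod_cast h1.trans h2
  · have hX : Prime (X 0 : MvPolynomial (Fin 2) k) := X_prime
    have hp : (Ideal.span {(X 0 : MvPolynomial (Fin 2) k)}).IsPrime :=
      (Ideal.span_singleton_prime hX.ne_zero).2 hX
    have h1 := Ideal.height_span_singleton_eq_one_of_mem_nonZeroDivisors
      (mem_nonZeroDivisors_of_ne_zero hX.ne_zero) hX.not_isUnit
    have hlt : Ideal.span {(X 0 : MvPolynomial (Fin 2) k)} < originIdeal k := by
      refine lt_of_le_of_ne (Ideal.span_mono (by simp)) fun he => ?_
      have : (X 1 : MvPolynomial (Fin 2) k) ∈ Ideal.span {(X 0 : MvPolynomial (Fin 2) k)} :=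
        he ▸ Ideal.subset_span (Set.mem_insert_of_mem _ rfl)
      have h2 := map_dvd evalAt (Ideal.mem_span_singleton.1 this)
      simp at h2
    have h3 := Ideal.height_add_one_le_of_lt_of_isPrime hlt
    rw [h1] at h3
    exact h3

theorem krullDimNat_planeLocalRing : krullDimNat (PlaneLocalRing k) = 2 := by
  rw [krullDimNat, IsLocalization.AtPrime.ringKrullDim_eq_height (originIdeal k),
    height_originIdeal]
  rfl

end Dimension

/-! ### Passage to the local ring, the F-signature formula and a bound for the F-pure threshold -/

section Local

variable {p : ℕ} [Fact p.Prime] [CharP k p]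

instance planeLocalRing_charP : CharP (PlaneLocalRing k) p :=
  charP_of_injective_algebraMap (algebraMap k (PlaneLocalRing k)).injective p

theorem frobeniusPower_maximalIdeal (e : ℕ) :
    frobeniusPower p (IsLocalRing.maximalIdeal (PlaneLocalRing k)) e =
      (powIdeal k (p ^ e)).map (algebraMap _ (PlaneLocalRing k)) := by
  have hm : IsLocalRing.maximalIdeal (PlaneLocalRing k) =
      Ideal.span {algebraMap (MvPolynomial (Fin 2) k) (PlaneLocalRing k) (X 0),
        algebraMap (MvPolynomial (Fin 2) k) (PlaneLocalRing k) (X 1)} := by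
    rw [← Localization.AtPrime.map_eq_maximalIdeal,
      congrArg (Ideal.map (algebraMap (MvPolynomial (Fin 2) k) (PlaneLocalRing k)))
        (show originIdeal k = Ideal.span {X 0, X 1} from rfl), Ideal.map_span, Set.image_pair]
  rw [powIdeal, Ideal.map_span, Set.image_pair, frobeniusPower, hm]
  refine le_antisymm ?_ ?_
  · rw [Ideal.span_le]
    rintro _ ⟨x, hx, rfl⟩
    obtain ⟨a, b, rfl⟩ := Ideal.mem_span_pair.1 hx
    refine Ideal.mem_span_pair.2 ⟨a ^ p ^ e, b ^ p ^ e, ?_⟩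
    simp only [add_pow_char_pow, mul_pow, map_pow]
  · rw [Ideal.span_le]
    rintro _ (rfl | rfl)
    · exact Ideal.subset_span ⟨_, Ideal.subset_span (Set.mem_insert _ _), by rw [map_pow]⟩
    · exact Ideal.subset_span ⟨_, Ideal.subset_span (Set.mem_insert_of_mem _ rfl), by rw [map_pow]⟩

theorem pow_mem_powIdeal {P : MvPolynomial (Fin 2) k} (hP : P ∈ originIdeal k) (e : ℕ) :
    P ^ p ^ e ∈ powIdeal k (p ^ e) := by
  obtain ⟨a, b, rfl⟩ := Ideal.mem_span_pair.1 hP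
  exact mem_powIdeal.2 ⟨a ^ p ^ e, b ^ p ^ e, by simp only [add_pow_char_pow, mul_pow]⟩

-- Modulo `(x^q, y^q)` such a `u` is a nonzero constant plus a nilpotent, hence a unit.
variable (p) in
theorem exists_mul_sub_one_mem {u : MvPolynomial (Fin 2) k} (hu : u ∉ originIdeal k) (e : ℕ) :
    ∃ v, v * u - 1 ∈ powIdeal k (p ^ e) := by
  have hc : constantCoeff u ≠ 0 := fun h => hu (mem_originIdeal.2 h)
  have hn : u - C (constantCoeff u) ∈ originIdeal k := by
    rw [mem_originIdeal, map_sub, constantCoeff_C, sub_self]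
  have h1 : IsNilpotent (Ideal.Quotient.mk (powIdeal k (p ^ e)) (u - C (constantCoeff u))) :=
    ⟨p ^ e, by rw [← map_pow, Ideal.Quotient.eq_zero_iff_mem]; exact pow_mem_powIdeal hn e⟩
  have h2 : IsUnit (Ideal.Quotient.mk (powIdeal k (p ^ e)) (C (constantCoeff u))) :=
    ((isUnit_iff_ne_zero.2 hc).map C).map _
  have h3 := h1.isUnit_add_left_of_commute h2 (Commute.all _ _)
  rw [← map_add, add_sub_cancel] at h3
  obtain ⟨w, hw⟩ := h3.exists_left_inv
  obtain ⟨v, rfl⟩ := Ideal.Quotient.mk_surjective w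
  exact ⟨v, by rwa [← map_mul, ← map_one (Ideal.Quotient.mk _), Ideal.Quotient.eq] at hw⟩

variable (p) in
theorem algebraMap_mem_map_powIdeal {P : MvPolynomial (Fin 2) k} (e : ℕ) :
    algebraMap _ (PlaneLocalRing k) P ∈
      (powIdeal k (p ^ e)).map (algebraMap _ (PlaneLocalRing k)) ↔ P ∈ powIdeal k (p ^ e) := by
  refine ⟨fun h => ?_, fun h => Ideal.mem_map_of_mem _ h⟩
  obtain ⟨u, hu, huP⟩ := (IsLocalization.algebraMap_mem_map_algebraMap_iff
    (originIdeal k).primeCompl _ _ _).1 h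
  obtain ⟨v, hv⟩ := exists_mul_sub_one_mem p hu e
  have : P = v * (u * P) - (v * u - 1) * P := by ring
  rw [this]
  exact Ideal.sub_mem _ (Ideal.mul_mem_left _ _ huP) (Ideal.mul_mem_right _ _ hv)

variable (p) in
theorem exists_sub_algebraMap_mem (x : PlaneLocalRing k) (e : ℕ) :
    ∃ P : MvPolynomial (Fin 2) k, x - algebraMap _ (PlaneLocalRing k) P ∈
      (powIdeal k (p ^ e)).map (algebraMap _ (PlaneLocalRing k)) := by
  obtain ⟨⟨s, u⟩, hx⟩ := IsLocalization.surj (originIdeal k).primeCompl x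
  obtain ⟨v, hv⟩ := exists_mul_sub_one_mem p u.2 e
  refine ⟨v * s, ?_⟩
  have h1 := Ideal.mem_map_of_mem (algebraMap _ (PlaneLocalRing k)) hv
  have : x - algebraMap _ (PlaneLocalRing k) (v * s) =
      -x * algebraMap _ (PlaneLocalRing k) (v * u - 1) := by
    rw [map_sub, map_mul, map_mul, ← hx, map_one]
    ring
  rw [this]
  exact Ideal.mul_mem_left _ _ h1

theorem exists_sub_algebraMap_mem_maximalIdeal (x : PlaneLocalRing k) :
    ∃ c : k, x - algebraMap k (PlaneLocalRing k) c ∈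
      IsLocalRing.maximalIdeal (PlaneLocalRing k) := by
  obtain ⟨⟨s, u⟩, hx⟩ := IsLocalization.surj (originIdeal k).primeCompl x
  have hu : constantCoeff (u : MvPolynomial (Fin 2) k) ≠ 0 := fun h => u.2 (mem_originIdeal.2 h)
  refine ⟨constantCoeff s / constantCoeff (u : MvPolynomial (Fin 2) k), ?_⟩
  have hn : s - C (constantCoeff s / constantCoeff (u : MvPolynomial (Fin 2) k)) *
      (u : MvPolynomial (Fin 2) k) ∈
      originIdeal k := by
    rw [mem_originIdeal, map_sub, map_mul, constantCoeff_C,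
      div_mul_cancel₀ _ hu, sub_self]
  have h2 := Ideal.mem_map_of_mem (algebraMap _ (PlaneLocalRing k)) hn
  rw [Localization.AtPrime.map_eq_maximalIdeal, map_sub, map_mul, ← hx, ← algebraMap_eq,
    ← IsScalarTower.algebraMap_apply, ← sub_mul] at h2
  exact (Ideal.mul_unit_mem_iff_mem _ (IsLocalization.map_units _ u)).1 h2

/-- Elements outside `⟨x, y⟩` are already invertible modulo `(x^q, y^q)`, so localization changes
neither the quotient nor membership in the colon ideal. -/
theorem length_quotient_colon {h : ℕ} {H : MvPolynomial (Fin 2) k} (hH : H.IsHomogeneous h)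
    (e : ℕ) :
    Module.length (PlaneLocalRing k) (PlaneLocalRing k ⧸ Submodule.colon
      (frobeniusPower p (IsLocalRing.maximalIdeal (PlaneLocalRing k)) e)
        {algebraMap _ (PlaneLocalRing k) H}) =
      Module.finrank k (MvPolynomial (Fin 2) k ⧸ colonIdeal (p ^ e) H) := by
  rw [frobeniusPower_maximalIdeal]
  set Q := (powIdeal k (p ^ e)).map (algebraMap _ (PlaneLocalRing k)) with hQ
  set J : Ideal (PlaneLocalRing k) := Submodule.colon Q {algebraMap _ (PlaneLocalRing k) H} with hJ
  let ψ : MvPolynomial (Fin 2) k →ₗ[k] PlaneLocalRing k ⧸ J :=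
    ((Ideal.Quotient.mkₐ k J).comp (IsScalarTower.toAlgHom k _ (PlaneLocalRing k))).toLinearMap
  have hψ : ∀ P, ψ P = Ideal.Quotient.mk J (algebraMap _ (PlaneLocalRing k) P) := fun P => rfl
  have hsurj : Function.Surjective ψ := by
    intro y
    obtain ⟨x, rfl⟩ := Ideal.Quotient.mk_surjective y
    obtain ⟨P, hP⟩ := exists_sub_algebraMap_mem p x e
    refine ⟨P, ?_⟩
    rw [hψ]
    refine (Ideal.Quotient.eq.2 ?_).symm
    rw [hJ, Submodule.mem_colon_singleton]
    exact Ideal.mul_mem_right _ _ hP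
  have hker : LinearMap.ker ψ = (colonIdeal (p ^ e) H).restrictScalars k := by
    ext P
    rw [LinearMap.mem_ker, hψ, Ideal.Quotient.eq_zero_iff_mem, hJ, Submodule.mem_colon_singleton,
      smul_eq_mul, ← map_mul, algebraMap_mem_map_powIdeal, ← mem_colonIdeal]
    rfl
  have e1 := (Submodule.Quotient.restrictScalarsEquiv k (colonIdeal (p ^ e) H)).symm.trans
    ((Submodule.quotEquivOfEq _ _ hker.symm).trans (ψ.quotKerEquivOfSurjective hsurj))
  have := (finrank_quotient_colonIdeal (q := p ^ e) hH).1
  have : FiniteDimensional k (PlaneLocalRing k ⧸ J) := Module.Finite.equiv e1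
  rw [e1.finrank_eq]
  exact length_eq_finrank exists_sub_algebraMap_mem_maximalIdeal

variable {r : ℕ} {f : MvPolynomial (Fin 2) k} (hf : f.IsHomogeneous r) (hf0 : f ≠ 0)

include hf hf0

theorem fSignatureTerm_eq (t : ℝ) (e : ℕ) :
    fSignatureTerm p (algebraMap _ (PlaneLocalRing k) f) t e =
      (r : ℝ) ^ 2 / 4 * (⌈t * ((p : ℝ) ^ e - 1)⌉₊ / (p : ℝ) ^ e) ^ 2 -
        r * (⌈t * ((p : ℝ) ^ e - 1)⌉₊ / (p : ℝ) ^ e) + 1 -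
        (gap (p ^ e) (f ^ ⌈t * ((p : ℝ) ^ e - 1)⌉₊) / (p : ℝ) ^ e / 2) ^ 2 := by
  have hp0 : 0 < p := (Fact.out : p.Prime).pos
  have hp : (0 : ℝ) < (p : ℝ) ^ e := by positivity
  set a := ⌈t * ((p : ℝ) ^ e - 1)⌉₊ with ha
  have h1 := four_mul_finrank_add_gap (pow_pos hp0 e) (hf.pow a) (pow_ne_zero a hf0)
  rw [fSignatureTerm, ← map_pow, ← ha, length_quotient_colon (hf.pow a), krullDimNat_planeLocalRing,
    ENat.toNat_natCast, pow_mul]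
  set D := Module.finrank k (MvPolynomial (Fin 2) k ⧸ colonIdeal (p ^ e) (f ^ a))
  have h2 : 4 * (D : ℝ) + 4 * (p : ℝ) ^ e * (r * a) + (gap (p ^ e) (f ^ a) : ℝ) ^ 2 =
      4 * ((p : ℝ) ^ e) ^ 2 + (r * a) ^ 2 := by exact_mod_cast h1
  have h3 : (D : ℝ) = ((p : ℝ) ^ e) ^ 2 + (r * a) ^ 2 / 4 - (p : ℝ) ^ e * (r * a) -
    (gap (p ^ e) (f ^ a) : ℝ) ^ 2 / 4 := by linarith
  rw [h3]
  field_simp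
  ring

theorem tendsto_fSignatureTerm {δ : C(ℝ≥0, ℝ)}
    (hδ : ∀ e a : ℕ, δ ((a : ℝ≥0) / (p : ℝ≥0) ^ e) = gap (p ^ e) (f ^ a) / (p : ℝ) ^ e)
    (t : ℝ≥0) :
    Tendsto (fSignatureTerm p (algebraMap _ (PlaneLocalRing k) f) (t : ℝ)) atTop
      (𝓝 ((r : ℝ) ^ 2 / 4 * (t : ℝ) ^ 2 - (r : ℝ) * (t : ℝ) + 1 - (δ t / 2) ^ 2)) := by
  have hc : Continuous fun x : ℝ≥0 =>
      (r : ℝ) ^ 2 / 4 * (x : ℝ) ^ 2 - (r : ℝ) * (x : ℝ) + 1 - (δ x / 2) ^ 2 := by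
    have := δ.continuous
    fun_prop
  refine ((hc.tendsto t).comp (tendsto_ceil_div (Fact.out : p.Prime).one_lt t)).congr fun e => ?_
  rw [fSignatureTerm_eq hf hf0, Function.comp_apply, hδ]
  push_cast
  rfl

-- If `r a ≥ 2 p^e`, then `f^a ∈ (x^(p^e), y^(p^e))`, which every `φ` maps into the maximal ideal,
-- so `φ (f^a) ≠ 1`. Letting `e → ∞` gives `t ≤ 2 / r`.
omit [CharP k p] hf0 in
theorem fPureThreshold_mul_le (hr : 0 < r) :
    r * fPureThreshold p (algebraMap _ (PlaneLocalRing k) f) ≤ 2 := by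
  have hr' : (0 : ℝ) < r := by exact_mod_cast hr
  have hp : (1 : ℝ) < p := by exact_mod_cast (Fact.out : p.Prime).one_lt
  rw [mul_comm, ← le_div_iff₀ hr']
  refine Real.sSup_le ?_ (by positivity)
  rintro t ⟨ht, hpure⟩
  have key : ∀ᶠ e : ℕ in atTop, (t : ℝ) - t * ((p : ℝ) ^ e)⁻¹ ≤ 2 / r + ((p : ℝ) ^ e)⁻¹ := by
    filter_upwards [hpure] with e he
    have hq : (0 : ℝ) < (p : ℝ) ^ e := by positivity
    obtain ⟨φ, h1, h2⟩ := he
    set a := ⌊t * ((p : ℝ) ^ e - 1)⌋₊ with ha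
    have hlt : r * a < 2 * p ^ e := by
      by_contra hc
      obtain ⟨c, d, hcd⟩ := mem_powIdeal.1 (mem_powIdeal_of_isHomogeneous (q := p ^ e)
        (hf.pow a) (by omega))
      have h3 : φ (algebraMap _ (PlaneLocalRing k) (f ^ a)) ∈
          IsLocalRing.maximalIdeal (PlaneLocalRing k) := by
        rw [← hcd, mul_comm c, mul_comm d, map_add, map_mul, map_mul, map_pow, map_pow, map_add,
          h1, h1, ← Localization.AtPrime.map_eq_maximalIdeal]
        refine Ideal.add_mem _ (Ideal.mul_mem_right _ _ (Ideal.mem_map_of_mem _ ?_))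
          (Ideal.mul_mem_right _ _ (Ideal.mem_map_of_mem _ ?_))
        · exact Ideal.subset_span (Set.mem_insert _ _)
        · exact Ideal.subset_span (Set.mem_insert_of_mem _ rfl)
      rw [map_pow, h2] at h3
      exact (Ideal.ne_top_iff_one _).1 (IsLocalRing.maximalIdeal.isMaximal _).ne_top h3
    have h3 : (r : ℝ) * a < 2 * (p : ℝ) ^ e := by exact_mod_cast hlt
    have h4 := Nat.lt_floor_add_one (t * ((p : ℝ) ^ e - 1))
    rw [← ha] at h4
    have h5 : (a : ℝ) < 2 / r * (p : ℝ) ^ e := by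
      rw [div_mul_eq_mul_div, lt_div_iff₀ hr', mul_comm]
      exact h3
    rw [← mul_le_mul_iff_left₀ hq, sub_mul, add_mul, mul_assoc, inv_mul_cancel₀ hq.ne']
    linarith
  have h0 : Tendsto (fun e : ℕ => ((p : ℝ) ^ e)⁻¹) atTop (𝓝 0) :=
    (tendsto_pow_atTop_atTop_of_one_lt hp).inv_tendsto_atTop
  have hlow : Tendsto (fun e : ℕ => (t : ℝ) - t * ((p : ℝ) ^ e)⁻¹) atTop (𝓝 t) := by
    simpa using tendsto_const_nhds.sub (h0.const_mul t)
  have hup : Tendsto (fun e : ℕ => (2 / r : ℝ) + ((p : ℝ) ^ e)⁻¹) atTop (𝓝 (2 / r)) := by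
    simpa using tendsto_const_nhds.add h0
  exact le_of_tendsto_of_tendsto hlow hup key

end Local

/-! ### Derivatives of syzygies and the bound for the gap at level `p` -/

theorem totalDegree_pderiv_lt {P : MvPolynomial (Fin 2) k} {i : Fin 2} (h : pderiv i P ≠ 0) :
    (pderiv i P).totalDegree < P.totalDegree := by
  obtain ⟨s, hs, hs'⟩ := Finset.exists_mem_eq_sup _ (support_nonempty.2 h)
    (fun s : Fin 2 →₀ ℕ => s.sum fun _ e => e)
  rw [totalDegree, hs']
  have h1 : s + Finsupp.single i 1 ∈ P.support := by
    rw [mem_support_iff] at hs ⊢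
    rw [coeff_pderiv] at hs
    exact left_ne_zero_of_mul hs
  refine lt_of_lt_of_le ?_ (le_totalDegree h1)
  rw [Finsupp.sum_add_index' (fun _ => rfl) fun _ _ _ => rfl, Finsupp.sum_single_index rfl]
  exact Nat.lt_succ_self _

theorem pderiv_eq_zero_of_dvd {P : MvPolynomial (Fin 2) k} {i : Fin 2} (h : P ∣ pderiv i P) :
    pderiv i P = 0 := by
  by_contra h0
  exact absurd (totalDegree_le_of_dvd_of_isDomain h h0) (not_le.2 (totalDegree_pderiv_lt h0))

/-- Differentiation multiplies a coefficient by an exponent, and exponents strictly between `0` and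
`p` are nonzero in `k`. -/
theorem exists_eq_C_of_pderiv_eq_zero {p : ℕ} [Fact p.Prime] [CharP k p]
    {P : MvPolynomial (Fin 2) k} (hdeg : P.totalDegree < p) (h : ∀ i, pderiv i P = 0) :
    ∃ c, P = C c := by
  refine ⟨coeff 0 P, totalDegree_eq_zero_iff_eq_C.1 ?_⟩
  rw [totalDegree_eq_zero_iff]
  intro m hm i
  by_contra hi
  have h1 := congrArg (coeff (m - Finsupp.single i 1)) (h i)
  have h2 : m - Finsupp.single i 1 + Finsupp.single i 1 = m :=
    tsub_add_cancel_of_le (by simpa [Finsupp.single_le_iff] using Nat.one_le_iff_ne_zero.2 hi)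
  rw [coeff_pderiv, h2, coeff_zero, mul_eq_zero] at h1
  have h3 := h1.resolve_left (mem_support_iff.1 hm)
  have h4 : ((m i : ℕ) : k) = 0 := by
    rw [← h3]
    simp only [Finsupp.tsub_apply, Finsupp.single_eq_same]
    rw [Nat.cast_sub (Nat.one_le_iff_ne_zero.2 hi)]
    simp
  have h5 := Nat.le_of_dvd (Nat.pos_of_ne_zero hi) ((CharP.cast_eq_zero_iff k p _).1 h4)
  have h6 := le_totalDegree hm
  have h7 : m i ≤ m.sum fun _ e => e := by
    rw [Finsupp.sum_fintype _ _ (fun _ => rfl)]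
    exact Finset.single_le_sum (f := fun i => m i) (fun _ _ => Nat.zero_le _) (Finset.mem_univ i)
  omega

theorem pderiv_eq_zero_of_mul_eq {P Q : MvPolynomial (Fin 2) k} (hPQ : IsRelPrime P Q) {i : Fin 2}
    (h : Q * pderiv i P = P * pderiv i Q) : pderiv i P = 0 ∧ pderiv i Q = 0 :=
  ⟨pderiv_eq_zero_of_dvd (hPQ.dvd_of_dvd_mul_left ⟨_, h⟩),
    pderiv_eq_zero_of_dvd (hPQ.symm.dvd_of_dvd_mul_left ⟨_, h.symm⟩)⟩

/-- Two polynomials with the same logarithmic derivatives are constant multiples of one polynomial,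
if their degrees are less than the characteristic. -/
theorem exists_common_factor {p : ℕ} [Fact p.Prime] [CharP k p] {P Q : MvPolynomial (Fin 2) k}
    (hPQ : P ≠ 0 ∨ Q ≠ 0) (hP : P.totalDegree < p) (hQ : Q.totalDegree < p)
    (h : ∀ i, Q * pderiv i P = P * pderiv i Q) :
    ∃ (w : MvPolynomial (Fin 2) k) (α β : k), w ≠ 0 ∧ P = w * C α ∧ Q = w * C β := by
  obtain ⟨P', Q', w, hrel, rfl, rfl⟩ : ∃ P' Q' w, IsRelPrime P' Q' ∧ w * P' = P ∧ w * Q' = Q :=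
    hPQ.elim (fun h => UniqueFactorizationMonoid.exists_reduced_factors _ h _)
      fun h => UniqueFactorizationMonoid.exists_reduced_factors' _ _ h
  have hw : w ≠ 0 := by
    rintro rfl
    simp at hPQ
  have hder : ∀ i, pderiv i P' = 0 ∧ pderiv i Q' = 0 := fun i => by
    refine pderiv_eq_zero_of_mul_eq hrel ?_
    have h1 := h i
    simp only [Derivation.leibniz, smul_eq_mul] at h1
    refine mul_left_cancel₀ (mul_ne_zero hw hw) ?_
    linear_combination h1
  have hdeg : ∀ T : MvPolynomial (Fin 2) k, (w * T).totalDegree < p → T.totalDegree < p := by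
    intro T hT
    rcases eq_or_ne T 0 with rfl | hT0
    · simpa using (Fact.out : p.Prime).pos
    · exact lt_of_le_of_lt (totalDegree_le_of_dvd_of_isDomain (dvd_mul_left T w)
        (mul_ne_zero hw hT0)) hT
  obtain ⟨α, rfl⟩ := exists_eq_C_of_pderiv_eq_zero (hdeg _ hP) fun i => (hder i).1
  obtain ⟨β, rfl⟩ := exists_eq_C_of_pderiv_eq_zero (hdeg _ hQ) fun i => (hder i).2
  exact ⟨w, α, β, hw, rfl, rfl⟩

/-- Derivations kill `x^p` and `y^p`, so differentiating the relation affects only the cofactors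
there. The factor `f` makes the derivative of `A₂ f^b` a multiple of `f^b` again. -/
theorem IsHomogeneousSyzygy.pderiv {p r b m : ℕ} [CharP k p]
    {f : MvPolynomial (Fin 2) k} (hf : f.IsHomogeneous r) {A : Fin 3 → MvPolynomial (Fin 2) k}
    (hA : IsHomogeneousSyzygy (powTriple p (f ^ b)) A m) (i : Fin 2) :
    IsHomogeneousSyzygy (powTriple p (f ^ b))
      ![f * MvPolynomial.pderiv i (A 0), f * MvPolynomial.pderiv i (A 1),
        f * MvPolynomial.pderiv i (A 2) + b * A 2 * MvPolynomial.pderiv i f] (r + (m - 1)) := by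
  obtain ⟨h, h0, h1, h2⟩ := isHomogeneousSyzygy_powTriple.1 hA
  have e : ∀ (P : MvPolynomial (Fin 2) k) (j : Fin 2),
      f * MvPolynomial.pderiv i P * X j ^ p = f * MvPolynomial.pderiv i (P * X j ^ p) :=
    fun P j => by
    rw [Derivation.leibniz, Derivation.leibniz_pow]
    simp [mul_comm, mul_left_comm]
  have e2 : (f * MvPolynomial.pderiv i (A 2) + b * A 2 * MvPolynomial.pderiv i f) * f ^ b =
      f * MvPolynomial.pderiv i (A 2 * f ^ b) := by
    rw [Derivation.leibniz, Derivation.leibniz_pow]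
    rcases b with _ | b
    · simp
    · simp only [smul_eq_mul, nsmul_eq_mul, Nat.add_sub_cancel]
      ring
  refine isHomogeneousSyzygy_powTriple.2 ⟨?_, ?_, ?_, ?_⟩
  · simp only [Matrix.cons_val]
    rw [e, e, e2, ← mul_add, ← mul_add, ← map_add, ← map_add, h, map_zero, mul_zero]
  · simp only [Matrix.cons_val]
    rw [e]
    exact hf.mul h0.pderiv
  · simp only [Matrix.cons_val]
    rw [e]
    exact hf.mul h1.pderiv
  · simp only [Matrix.cons_val]
    rw [e2]
    exact hf.mul h2.pderiv

theorem totalDegree_add_of_mul_isHomogeneous {P u : MvPolynomial (Fin 2) k} {m n : ℕ}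
    (hP : P.IsHomogeneous m) (hP0 : P ≠ 0) (hu : u ≠ 0) (h : (u * P).IsHomogeneous n) :
    u.totalDegree + m = n := by
  rw [← hP.totalDegree hP0, ← totalDegree_mul_of_isDomain hu hP0]
  exact h.totalDegree (mul_ne_zero hu hP0)

section LinearForms

variable {r : ℕ} {l : Fin r → MvPolynomial (Fin 2) k} (hl : AreDistinctLinearForms l)

include hl

theorem _root_.AreDistinctLinearForms.prod_isHomogeneous : (∏ i, l i).IsHomogeneous r := by
  simpa using IsHomogeneous.prod Finset.univ l (fun _ => 1) fun i _ => (hl.1 i).1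

theorem _root_.AreDistinctLinearForms.prod_ne_zero : ∏ i, l i ≠ 0 :=
  Finset.prod_ne_zero_iff.2 fun i _ => (hl.1 i).2

theorem _root_.AreDistinctLinearForms.irreducible (i : Fin r) : Irreducible (l i) := by
  refine irreducible_of_totalDegree_eq_one ((hl.1 i).1.totalDegree (hl.1 i).2) fun x hx => ?_
  obtain ⟨m, hm⟩ := exists_coeff_ne_zero (hl.1 i).2
  exact isUnit_iff_ne_zero.2 (ne_zero_of_dvd_ne_zero hm (hx m))

/-- If `∏ lᵢ^b` divides `w γ^n` with `γ` a nonzero linear form, then the product of all but one of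
the `lᵢ^b` divides `w`. -/
theorem _root_.AreDistinctLinearForms.le_totalDegree (hr : 0 < r) {w γ : MvPolynomial (Fin 2) k}
    (hw : w ≠ 0) (hγ : γ.IsHomogeneous 1) (hγ0 : γ ≠ 0) {b n : ℕ}
    (hdvd : (∏ i, l i) ^ b ∣ w * γ ^ n) : (r - 1) * b ≤ w.totalDegree := by
  classical
  -- Two coprime linear forms cannot both divide `γ`, by degree; so at most one index is lost.
  obtain ⟨i₀, hi₀⟩ : ∃ i₀, ∀ i, i ≠ i₀ → ¬ l i ∣ γ := by
    by_cases hex : ∃ i₀, l i₀ ∣ γ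
    · obtain ⟨i₀, hi₀⟩ := hex
      refine ⟨i₀, fun i hi hiγ => ?_⟩
      have h1 := totalDegree_le_of_dvd_of_isDomain ((hl.2 i i₀ hi).mul_dvd hiγ hi₀) hγ0
      rw [hγ.totalDegree hγ0, totalDegree_mul_of_isDomain (hl.1 i).2 (hl.1 i₀).2,
        (hl.1 i).1.totalDegree (hl.1 i).2, (hl.1 i₀).1.totalDegree (hl.1 i₀).2] at h1
      omega
    · exact ⟨⟨0, hr⟩, fun i _ hi => hex ⟨i, hi⟩⟩
  have h1 : ∏ i ∈ Finset.univ.erase i₀, l i ^ b ∣ w := by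
    refine Finset.prod_dvd_of_isRelPrime (fun i _ j _ hij => (hl.2 i j hij).pow) fun i hi => ?_
    have h2 : l i ^ b ∣ w * γ ^ n :=
      (pow_dvd_pow_of_dvd (Finset.dvd_prod_of_mem l (Finset.mem_univ i)) b).trans hdvd
    refine IsRelPrime.dvd_of_dvd_mul_right (IsRelPrime.pow ?_) h2
    exact ((hl.irreducible i).isRelPrime_iff_not_dvd).2 (hi₀ i (Finset.ne_of_mem_erase hi))
  have h2 : (∏ i ∈ Finset.univ.erase i₀, l i ^ b).IsHomogeneous ((r - 1) * b) := by
    have := IsHomogeneous.prod (Finset.univ.erase i₀) (fun i => l i ^ b) (fun _ => 1 * b)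
      fun i _ => (hl.1 i).1.pow b
    simpa [Finset.card_erase_of_mem] using this
  rw [← h2.totalDegree (Finset.prod_ne_zero_iff.2 fun i _ => pow_ne_zero _ (hl.1 i).2)]
  exact totalDegree_le_of_dvd_of_isDomain h1 hw

variable {p : ℕ} [Fact p.Prime] [CharP k p] [PerfectField k]

theorem _root_.AreDistinctLinearForms.gap_le (hr : 2 ≤ r) {b : ℕ} (hb : r * b + 2 ≤ 2 * p) :
    gap p ((∏ i, l i) ^ b) ≤ r := by
  have hf := hl.prod_isHomogeneous
  have hf0 := hl.prod_ne_zero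
  set f := ∏ i, l i with hfdef
  have hp : 0 < p := (Fact.out : p.Prime).pos
  by_contra! hgap
  obtain ⟨A, v, m, hpair⟩ := exists_isGeneratingPair_gap hp (hf.pow b) (pow_ne_zero b hf0)
  have hadd := hpair.add_eq hp (hf.pow b) (pow_ne_zero b hf0)
  have hv0 := hpair.right_ne_zero hp (hf.pow b) (pow_ne_zero b hf0)
  obtain ⟨hv, hv₀, hv₁, hv₂⟩ := isHomogeneousSyzygy_powTriple.1 hpair.right
  have hlog : ∀ i, v 1 * pderiv i (v 0) = v 0 * pderiv i (v 1) := fun i => by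
    -- If the gap exceeds `r`, the differentiated syzygy lies below the degree `m + gap` of the
    -- other generator, hence is a multiple of `v`.
    obtain ⟨g, hg⟩ := hpair.exists_eq_smul (powTriple_ne_zero (pow_ne_zero b hf0))
      (n := r + (m - 1)) (by omega) (IsHomogeneousSyzygy.pderiv hf hpair.right i)
    have g0 := congrFun hg 0
    have g1 := congrFun hg 1
    simp only [Matrix.cons_val, Pi.smul_apply, smul_eq_mul] at g0 g1
    refine mul_left_cancel₀ hf0 ?_
    linear_combination v 1 * g0 - v 0 * g1
  have hdeg : ∀ {j : Fin 2} {P : MvPolynomial (Fin 2) k}, (P * X j ^ p).IsHomogeneous m → P ≠ 0 →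
      P.totalDegree + p = m := fun h h' =>
    totalDegree_add_of_mul_isHomogeneous (isHomogeneous_X_pow _ _) (pow_ne_zero _ (X_ne_zero _)) h' h
  -- From `2m + gap = 2p + rb ≤ 4p - 2` one gets `m < 2p`. This is where `hb` is needed: degrees
  -- below `p` make vanishing derivatives imply constancy.
  have hdeg' : ∀ {j : Fin 2} {P : MvPolynomial (Fin 2) k}, (P * X j ^ p).IsHomogeneous m →
      P.totalDegree < p := fun {j P} h => by
    rcases eq_or_ne P 0 with rfl | h'
    · simpa using hp
    · have := hdeg h h'
      omega
  have hne : v 0 ≠ 0 ∨ v 1 ≠ 0 := by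
    by_contra! hc
    rw [hc.1, hc.2, zero_mul, zero_mul, zero_add, zero_add] at hv
    have h2 := (mul_eq_zero.1 hv).resolve_right (pow_ne_zero b hf0)
    refine hv0 (funext fun i => ?_)
    fin_cases i
    · exact hc.1
    · exact hc.2
    · exact h2
  obtain ⟨w, α, β, hw, e0, e1⟩ := exists_common_factor hne (hdeg' hv₀) (hdeg' hv₁) hlog
  have hwdeg : w.totalDegree + p = m := by
    have aux : ∀ {j : Fin 2} {P : MvPolynomial (Fin 2) k} {c : k}, P = w * C c → P ≠ 0 →
        (P * X j ^ p).IsHomogeneous m → w.totalDegree + p = m := by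
      rintro j _ c rfl h0 h
      rw [← hdeg h h0, totalDegree_mul_of_isDomain hw (right_ne_zero_of_mul h0), totalDegree_C,
        add_zero]
    exact hne.elim (fun h => aux e0 h hv₀) fun h => aux e1 h hv₁
  -- With `α`, `β` written as `p`-th powers, `v₀ x^p + v₁ y^p` becomes `w γ^p` for a linear form
  -- `γ`.
  obtain ⟨α, rfl⟩ := surjective_frobenius k p α
  obtain ⟨β, rfl⟩ := surjective_frobenius k p β
  have hγp : (C α * X 0 + C β * X 1 : MvPolynomial (Fin 2) k) ^ p =
      C (α ^ p) * X 0 ^ p + C (β ^ p) * X 1 ^ p := by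
    rw [add_pow_char, mul_pow, mul_pow, C_pow, C_pow]
  have hγ : (C α * X 0 + C β * X 1 : MvPolynomial (Fin 2) k).IsHomogeneous 1 :=
    (isHomogeneous_C_mul_X α 0).add (isHomogeneous_C_mul_X β 1)
  have hγ0 : (C α * X 0 + C β * X 1 : MvPolynomial (Fin 2) k) ≠ 0 := by
    intro h0
    have hα : α = 0 := by simpa using congrArg (eval ![1, 0]) h0
    have hβ : β = 0 := by simpa using congrArg (eval ![0, 1]) h0
    rw [hα, map_zero, C_0, mul_zero] at e0
    rw [hβ, map_zero, C_0, mul_zero] at e1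
    exact hne.elim (fun h => h e0) fun h => h e1
  have hdvd : f ^ b ∣ w * (C α * X 0 + C β * X 1) ^ p := by
    refine ⟨-v 2, ?_⟩
    rw [hγp]
    rw [e0, e1, frobenius_def, frobenius_def] at hv
    linear_combination hv
  have hle := hl.le_totalDegree (by omega) hw hγ hγ0 hdvd
  -- The contradiction: `(r - 1) b ≤ m - p`, while `2 (m - p) = rb - gap`, so `(r - 2) b + gap ≤ 0`.
  obtain ⟨r, rfl⟩ := Nat.exists_eq_add_of_le hr
  rw [show 2 + r - 1 = r + 1 by omega] at hle
  nlinarith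

/-- A fraction `M / p` within `2 / p` of `t` has value at most `r / p`; the Lipschitz constant `r`
adds `2r / p`. -/
theorem _root_.AreDistinctLinearForms.gapFunction_le (hr : 2 ≤ r) {δ : C(ℝ≥0, ℝ)}
    (hlip : LipschitzWith r δ)
    (hδ : ∀ e a : ℕ, δ ((a : ℝ≥0) / (p : ℝ≥0) ^ e) =
      gap (p ^ e) ((∏ i, l i) ^ a) / (p : ℝ) ^ e) {t : ℝ≥0} (ht : r * (t : ℝ) ≤ 2) :
    |δ t| ≤ 3 * r / p := by
  have hp : 0 < p := (Fact.out : p.Prime).pos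
  have hp' : (0 : ℝ) < p := by exact_mod_cast hp
  have ht0 : (0 : ℝ) ≤ t := t.2
  set N := ⌊(t : ℝ) * p⌋₊ with hN
  have hN1 : (N : ℝ) ≤ t * p := Nat.floor_le (by positivity)
  have hN2 : (t : ℝ) * p < N + 1 := Nat.lt_floor_add_one _
  have hrN : r * N ≤ 2 * p := by
    have : (r : ℝ) * N ≤ 2 * p := by
      calc (r : ℝ) * N ≤ r * (t * p) := by gcongr
        _ = r * t * p := by ring
        _ ≤ 2 * p := by gcongr
    exact_mod_cast this
  have hb : r * (N - 1) + 2 ≤ 2 * p := by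
    rcases N with _ | N
    · simp; omega
    · rw [Nat.add_sub_cancel]
      rw [mul_add] at hrN
      omega
  -- The floor `N` only satisfies `rN ≤ 2p`; lowering it by one gains `r ≥ 2`, as `gap_le` requires.
  -- For `N = 0` truncation gives `M = 0`, which is still admissible.
  obtain ⟨M, hM⟩ : ∃ M, M = N - 1 := ⟨_, rfl⟩
  rw [← hM] at hb
  have hgap : (gap p ((∏ i, l i) ^ M) : ℝ) ≤ r := by exact_mod_cast hl.gap_le hr hb
  have hval := hδ 1 M
  rw [pow_one, pow_one, pow_one] at hval
  have hdist := hlip.dist_le_mul t ((M : ℝ≥0) / (p : ℝ≥0))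
  rw [Real.dist_eq, NNReal.dist_eq, hval] at hdist
  push_cast at hdist
  have hclose : |(t : ℝ) - (M : ℝ) / p| ≤ 2 / p := by
    have e : (t : ℝ) - (M : ℝ) / p = (t * p - (M : ℝ)) / p := by
      field_simp
    have h1 : (M : ℝ) ≤ N := by exact_mod_cast (by omega : M ≤ N)
    have h2 : (N : ℝ) ≤ (M : ℝ) + 1 := by exact_mod_cast (by omega : N ≤ M + 1)
    rw [e, abs_div, abs_of_pos hp']
    refine div_le_div_of_nonneg_right ?_ hp'.le
    rw [abs_le]
    constructor <;> linarith
  have h3 : |δ t| ≤ |δ t - gap p ((∏ i, l i) ^ M) / p| +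
      |(gap p ((∏ i, l i) ^ M) / p : ℝ)| := by
    simpa using abs_add_le (δ t - gap p ((∏ i, l i) ^ M) / p)
      (gap p ((∏ i, l i) ^ M) / p : ℝ)
  have h4 : |(gap p ((∏ i, l i) ^ M) / p : ℝ)| ≤ r / p := by
    rw [abs_of_nonneg (by positivity)]
    gcongr
  have h5 : (r : ℝ) * |(t : ℝ) - (M : ℝ) / p| ≤ r * (2 / p) := by gcongr
  have h6 : (3 : ℝ) * r / p = r * (2 / p) + r / p := by ring
  linarith

end LinearForms

end PlaneSyzygy

/-! ### The main theorem -/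

open PlaneSyzygy

theorem mainTheorem3 (r : ℕ) (hr : 2 ≤ r) :
    (∀ (p : ℕ) [Fact p.Prime] (k : Type*) [Field k] [CharP k p] [PerfectField k]
        (l : Fin r → MvPolynomial (Fin 2) k), AreDistinctLinearForms l →
      (∀ e a : ℕ, ∃! d : ℕ, IsSyzygyGap (frobeniusTriple p (∏ i, l i) e a) d) ∧
      ∃ δ : C(ℝ≥0, ℝ),
        IsSyzygyGapFunction p (∏ i, l i) δ ∧
        (∀ δ' : C(ℝ≥0, ℝ), IsSyzygyGapFunction p (∏ i, l i) δ' → δ' = δ) ∧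
        ∀ t : ℝ≥0,
          Tendsto
            (fSignatureTerm p (algebraMap _ (PlaneLocalRing k) (∏ i, l i)) (t : ℝ)) atTop
            (𝓝 (fSignature p (algebraMap _ (PlaneLocalRing k) (∏ i, l i)) (t : ℝ))) ∧
          fSignature p (algebraMap _ (PlaneLocalRing k) (∏ i, l i)) (t : ℝ) =
            (r : ℝ) ^ 2 / 4 * (t : ℝ) ^ 2 - (r : ℝ) * (t : ℝ) + 1 - (δ t / 2) ^ 2) ∧
    (∀ ε : ℝ, 0 < ε → ∃ P : ℕ, ∀ (p : ℕ) [Fact p.Prime], P ≤ p →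
      ∀ (k : Type*) [Field k] [CharP k p] [PerfectField k]
        (l : Fin r → MvPolynomial (Fin 2) k), AreDistinctLinearForms l →
      ∀ t ∈ Set.Icc (0 : ℝ)
          (fPureThreshold p (algebraMap _ (PlaneLocalRing k) (∏ i, l i))),
        |fSignature p (algebraMap _ (PlaneLocalRing k) (∏ i, l i)) t -
          ((r : ℝ) ^ 2 / 4 * t ^ 2 - (r : ℝ) * t + 1)| < ε) := by
  refine ⟨fun p _ k _ _ _ l hl => ?_, fun ε hε => ?_⟩
  · have hp : p.Prime := Fact.out
    have hf := hl.prod_isHomogeneous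
    have hf0 := hl.prod_ne_zero
    have hgap : ∀ e a, IsSyzygyGap (frobeniusTriple p (∏ i, l i) e a)
        (gap (p ^ e) ((∏ i, l i) ^ a)) := fun e a =>
      isSyzygyGap_gap (pow_pos hp.pos e) (hf.pow a) (pow_ne_zero a hf0)
    obtain ⟨δ, -, hδ⟩ := exists_gapFunction hf hf0 p
    refine ⟨fun e a => existsUnique_isSyzygyGap (pow_pos hp.pos e) (hf.pow a)
      (pow_ne_zero a hf0), δ, fun e a d hd => ?_, fun δ' hδ' => ?_, fun t => ?_⟩
    · rw [eq_gap (pow_pos hp.pos e) (hf.pow a) (pow_ne_zero a hf0) hd]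
      exact hδ e a
    · exact eq_of_eq_on_fractions hp.one_lt fun e a => by rw [hδ, hδ' e a _ (hgap e a)]
    · have ht := tendsto_fSignatureTerm hf hf0 hδ t
      have he := ht.limUnder_eq
      rw [fSignature, he]
      exact ⟨ht, rfl⟩
  -- For `p ≥ P` this yields `(3r)² < p ε ≤ p² ε`, so the error term `(δ t / 2)²` is below `ε`.
  · obtain ⟨P, hP⟩ := exists_nat_gt ((3 * r : ℝ) ^ 2 / ε)
    refine ⟨P, fun p _ hPp k _ _ _ l hl t ht => ?_⟩
    have hp : p.Prime := Fact.out
    have hp1 : (1 : ℝ) ≤ p := by exact_mod_cast hp.one_le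
    have hp0 : (0 : ℝ) < p := by linarith
    have hf := hl.prod_isHomogeneous
    have hf0 := hl.prod_ne_zero
    obtain ⟨δ, hlip, hδ⟩ := exists_gapFunction hf hf0 p
    lift t to ℝ≥0 using ht.1
    have hrt : r * (t : ℝ) ≤ 2 := (mul_le_mul_of_nonneg_left ht.2 (Nat.cast_nonneg r)).trans
      (fPureThreshold_mul_le hf (by omega))
    have hle := hl.gapFunction_le hr hlip hδ hrt
    rw [fSignature, (tendsto_fSignatureTerm hf hf0 hδ t).limUnder_eq, sub_sub_cancel_left, abs_neg,
      abs_of_nonneg (sq_nonneg _)]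
    have h1 : (3 * r : ℝ) ^ 2 < p * ε := by
      rw [← div_lt_iff₀ hε]
      exact hP.trans_le (by exact_mod_cast hPp)
    have h2 : (3 * (r : ℝ) / p) ^ 2 < ε := by
      rw [div_pow, div_lt_iff₀ (by positivity)]
      nlinarith
    have h3 : δ t ^ 2 ≤ (3 * (r : ℝ) / p) ^ 2 := by
      rw [← sq_abs]
      gcongr
    have h4 := sq_nonneg (δ t)
    rw [div_pow]
    linarith
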